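/- Let $(T(t))_{t\ge 0}$ be a $C_0$-semigroup with generator $A$ on a complex Hilbert space $X$. Suppose that there exist $\beta, C'\ge 0$ such that every $\lambda\in\mathbb{C}$ with $\operatorname{Re}\lambda\ge 0$ belongs to the resolvent set $\rho(A)$ and the resolvent $R(\lambda,A)=(\lambda-A)^{-1}$ satisfies $$\|R(\lambda,A)\|_{\mathcal{L}(X)}\le C'(1+|\lambda|)^{\beta}\qquad(\operatorname{Re}\lambda\ge 0).$$ Then for each $s\ge 0$ there exists $C\ge 0$ such that $$\|T(t)x\|_X\le C\,t^{-s}\,\|x\|_{D((-A)^{(s+1)\beta})}$$ for all $x\in D((-A)^{(s+1)\beta})$ and all $t\ge 1$. Here, for $\alpha\ge 0$, $(-A)^{\alpha}$ is the usual fractional power of $-A$, that is, the inverse of the injective bounded operator $(-A)^{-\alpha}=(-A)^{-\lfloor\alpha\rfloor}(-A)^{-\theta}$, where $\theta=\alpha-\lfloor\alpha\rfloor$, $(-A)^{-0}=I$ and $(-A)^{-\theta}=\frac{\sin \pi\theta}{\pi}\int_0^\infty r^{-\theta}R(r,A)\,dr$ for $0<\theta<1$; its domain is the range of $(-A)^{-\alpha}$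 and carries the graph norm $\|x\|_{D((-A)^{\alpha})}=\|x\|_X+\|(-A)^{\alpha}x\|_X$. No a priori bound on the growth of the semigroup is assumed. -/

import Mathlib

open Filter Topology MeasureTheory Set

noncomputable section

/-- `T : [0, ∞) → L(X)` is a `C₀`-semigroup on `X`: `T(0) = I`, `T(r + t) = T(r) T(t)` for
`r, t ≥ 0`, and every orbit `t ↦ T(t) x` is continuous on `[0, ∞)`.
(The values of `T` at negative times are irrelevant.) -/
structure IsC0Semigroup {X : Type*} [NormedAddCommGroup X] [NormedSpace ℂ X]
    (T : ℝ → X →L[ℂ] X) : Prop where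
  map_zero : T 0 = 1
  map_add : ∀ r t : ℝ, 0 ≤ r → 0 ≤ t → T (r + t) = T r * T t
  continuousOn_orbit : ∀ x : X, ContinuousOn (fun t : ℝ => T t x) (Ici 0)

/-- `y = lim_{h ↓ 0} (T(h) x - x) / h`. -/
def HasGeneratorValue {X : Type*} [NormedAddCommGroup X] [NormedSpace ℂ X]
    (T : ℝ → X →L[ℂ] X) (x y : X) : Prop :=
  Tendsto (fun h : ℝ => h⁻¹ • (T h x - x)) (𝓝[>] 0) (𝓝 y)

theorem HasGeneratorValue.add {X : Type*} [NormedAddCommGroup X] [NormedSpace ℂ X]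
    {T : ℝ → X →L[ℂ] X} {x y x' y' : X} (h : HasGeneratorValue T x y)
    (h' : HasGeneratorValue T x' y') : HasGeneratorValue T (x + x') (y + y') := by
  unfold HasGeneratorValue at *
  refine (h.add h').congr fun r => ?_
  rw [map_add, ← smul_add]
  congr 1
  abel

theorem HasGeneratorValue.smul {X : Type*} [NormedAddCommGroup X] [NormedSpace ℂ X]
    {T : ℝ → X →L[ℂ] X} {x y : X} (c : ℂ) (h : HasGeneratorValue T x y) :
    HasGeneratorValue T (c • x) (c • y) := by
  unfold HasGeneratorValue at *
  refine (h.const_smul c).congr fun r => ?_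
  rw [map_smul, ← smul_sub, smul_comm]

/-- The (infinitesimal) generator `A` of `T`: its domain is the set of all `x` for which
`lim_{h ↓ 0} (T(h) x - x) / h` exists in `X`, and `A x` is that limit. -/
def semigroupGenerator {X : Type*} [NormedAddCommGroup X] [NormedSpace ℂ X]
    (T : ℝ → X →L[ℂ] X) : X →ₗ.[ℂ] X where
  domain :=
    { carrier := {x | ∃ y, HasGeneratorValue T x y}
      add_mem' := fun ⟨y, hy⟩ ⟨y', hy'⟩ => ⟨y + y', hy.add hy'⟩
      zero_mem' := ⟨0, by simp [HasGeneratorValue]⟩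
      smul_mem' := fun c _ ⟨y, hy⟩ => ⟨c • y, hy.smul c⟩ }
  toFun :=
    { toFun := fun x => Classical.choose x.2
      map_add' := fun x x' => tendsto_nhds_unique (Classical.choose_spec (x + x').2)
        ((Classical.choose_spec x.2).add (Classical.choose_spec x'.2))
      map_smul' := fun c x => tendsto_nhds_unique (Classical.choose_spec (c • x).2)
        ((Classical.choose_spec x.2).smul c) }

/-- The bounded operator `R` is a two-sided inverse of `λ - A : D(A) → X`. -/
def IsResolventAt {X : Type*} [NormedAddCommGroup X] [NormedSpace ℂ X]
    (A : X →ₗ.[ℂ] X) (z : ℂ) (R : X →L[ℂ] X) : Prop :=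
  (∀ x : X, ∃ h : R x ∈ A.domain, z • R x - A ⟨R x, h⟩ = x) ∧
    ∀ x : A.domain, R (z • (x : X) - A x) = x

/-- The resolvent set `ρ(A)`. -/
def LinearPMap.resolventSet {X : Type*} [NormedAddCommGroup X] [NormedSpace ℂ X]
    (A : X →ₗ.[ℂ] X) : Set ℂ :=
  {z | ∃ R : X →L[ℂ] X, IsResolventAt A z R}

open Classical in
/-- The resolvent operator `R(λ, A) = (λ - A)⁻¹` for `λ ∈ ρ(A)` (and `0` for `λ ∉ ρ(A)`). -/
def LinearPMap.resolvent {X : Type*} [NormedAddCommGroup X] [NormedSpace ℂ X]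
    (A : X →ₗ.[ℂ] X) (z : ℂ) : X →L[ℂ] X :=
  if h : z ∈ A.resolventSet then Classical.choose h else 0

/-- Balakrishnan's formula for `0 < θ < 1`:
`B^{-θ} = (sin (π θ) / π) ∫_0^∞ t^{-θ} (t + B)⁻¹ dt`, where `(t + B)⁻¹ = R(t, -B)`.
For `0 ∈ ρ(B)` and `(-∞, 0] ⊆ ρ(B)` with `sup_{t ≥ 0} (1 + t) ‖(t + B)⁻¹‖ < ∞`
the integral converges absolutely in operator norm. -/
def LinearPMap.balakrishnan {X : Type*} [NormedAddCommGroup X] [NormedSpace ℂ X]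
    (B : X →ₗ.[ℂ] X) (θ : ℝ) : X →L[ℂ] X :=
  (Real.sin (Real.pi * θ) / Real.pi) •
    ∫ t in Ioi (0 : ℝ), t ^ (-θ) • (-B).resolvent (t : ℂ)

/-- The bounded operator `B^{-α}`, `α ≥ 0`, for an invertible sectorial (nonnegative) operator `B`:
`B^{-α} = (B⁻¹)^n B^{-θ}` with `n = ⌊α⌋` and `θ = α - n ∈ [0, 1)`, where `B^{-0} = I`
and `B⁻¹ = R(0, -B)`. -/
def LinearPMap.negPow {X : Type*} [NormedAddCommGroup X] [NormedSpace ℂ X]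
    (B : X →ₗ.[ℂ] X) (α : ℝ) : X →L[ℂ] X :=
  (-B).resolvent 0 ^ ⌊α⌋₊ * (if Int.fract α = 0 then 1 else B.balakrishnan (Int.fract α))

/-- The fractional power `B^α`, `α ≥ 0`, of an invertible sectorial (nonnegative) operator `B`: the
(in general unbounded) inverse of the injective bounded operator `B^{-α}`. Its domain is the range
of `B^{-α}`. -/
def LinearPMap.fracPow {X : Type*} [NormedAddCommGroup X] [NormedSpace ℂ X]
    (B : X →ₗ.[ℂ] X) (α : ℝ) : X →ₗ.[ℂ] X :=
  ((B.negPow α : X →ₗ[ℂ] X).toPMap ⊤).inverse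

/-- The graph norm `‖x‖_{D(B)} = ‖x‖ + ‖B x‖` on the domain of `B`. -/
def LinearPMap.graphNorm {X : Type*} [NormedAddCommGroup X] [NormedSpace ℂ X]
    (B : X →ₗ.[ℂ] X) (x : B.domain) : ℝ :=
  ‖(x : X)‖ + ‖B x‖

end

/-! Write R(z) for the resolvent and α = (s + 1)β. Two mechanisms carry the proof.

Decay from resolvent bounds (`exists_pow_mul_norm_apply_le`). If D commutes with the resolvents and
R(z)^N D, R(z)^(N+1) D are bounded by K on Re z ≥ 0, then t^N ‖T(t) D y‖ ≤ c K ‖y‖. Indeed t^N T(t)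
D y has Laplace transform N! R(z)^(N+1) D y, and for w = ω + 1 the resolvent identity R(z) = R(z+w)
+ w R(z) R(z+w) rewrites this as N! (R(z)^N D + w R(z)^(N+1) D) R(z+w) y. On Re z = σ the last
factor is in L², uniformly in σ > 0, by Plancherel, because e^{-(σ+w)t} T(t) decays exponentially. A
second use of Plancherel bounds e^{-σt} t^N T(t) D y in L²; taking σ = 1/t and comparing T(t) with
T(τ) for τ in [t - 1/2, t] makes the bound pointwise. Below the growth bound ω the transform is not
known to converge, so Fourier inversion is done on a line Re z > ω and moved to Re z = σ by Cauchy's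
theorem. This is legitimate for the orbit multiplied by 1 - e^{-wt} and for y in the dense range of
R(0)^p, where the transform is O(|z|^{-2}).

Splitting without loss (`exists_negPow_eq_add`). Each factor R(z) costs |z|^β and (-A)^{-α} gains
|z|^{-α}. With N = ⌊s⌋, the order α is enough for N + 1 resolvents and in general too small for N +
2. So (-A)^{-α} is split at a scale μ as D + E, using the bounded operators P = μR(μ) and 1 - P = -A
R(μ) as smooth cutoffs below and above μ. Then D satisfies the bounds for N with a gain μ^{-(s-N)β},
E those for N + 1 with a loss μ^{(N+1-s)β}. At μ = t^{1/β} both contributions are t^{-s}.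

All operator estimates are proved in a commutative Banach algebra (`exists_negPow_model`) by
induction from the resolvent identity. Of the fractional part (-A)^{-θ} only `IsNegPowLike` and
injectivity are used. -/

noncomputable section

/-! ### Plancherel and contour shifting -/

open FourierTransform in
/-- Plancherel's theorem for functions in `L¹ ∩ L²`. -/
theorem eLpNorm_fourier_eq_of_integrable {E : Type*} [NormedAddCommGroup E]
    [InnerProductSpace ℂ E] [CompleteSpace E] {f : ℝ → E} (hf : Integrable f)
    (hf2 : MemLp f 2) : eLpNorm (𝓕 f) 2 = eLpNorm f 2 := by
  have hcont : Continuous (𝓕 f) := by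
    exact VectorFourier.fourierIntegral_continuous (μ := volume) (L := innerₗ ℝ)
      Real.continuous_fourierChar continuous_inner hf
  have hae : (𝓕 (hf2.toLp f) : Lp (α := ℝ) E 2 volume) =ᵐ[volume] 𝓕 f := by
    set h : Lp (α := ℝ) E 2 volume := 𝓕 (hf2.toLp f)
    have hli : LocallyIntegrable (fun x => h x - 𝓕 f x) volume :=
      ((Lp.memLp h).locallyIntegrable (by norm_num)).sub hcont.locallyIntegrable
    -- The L² transform and the Fourier integral are compared as distributions: against a test
    -- function both reduce to the integral of its transform times f.
    have key : ∀ᵐ x, h x - 𝓕 f x = 0 := by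
      apply ae_eq_zero_of_integral_contDiff_smul_eq_zero hli
      intro g hg hgc
      set gC : ℝ → ℂ := fun x => (g x : ℂ)
      have hgC : ContDiff ℝ (⊤ : ℕ∞) gC := Complex.ofRealCLM.contDiff.comp hg
      have hgCc : HasCompactSupport gC := hgc.comp_left (g := fun r : ℝ => (r : ℂ)) (by simp)
      let gS : SchwartzMap ℝ ℂ := hgCc.toSchwartzMap hgC
      have hgS : ∀ x, gS x = (g x : ℂ) := fun x => rfl
      have e1 := congrArg (fun u => u gS)
        (MeasureTheory.Lp.fourier_toTemperedDistribution_eq (hf2.toLp f))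
      simp only [TemperedDistribution.fourier_apply,
        MeasureTheory.Lp.toTemperedDistribution_apply] at e1
      have e2 : ∫ x, (𝓕 gS) x • (hf2.toLp f) x = ∫ x, (𝓕 gS) x • f x := by
        apply integral_congr_ae
        filter_upwards [hf2.coeFn_toLp] with x hx
        rw [hx]
      have e3 : ∫ x, (𝓕 gS) x • f x = ∫ x, gS x • (𝓕 f) x := by
        have := VectorFourier.integral_fourierIntegral_smul_eq_flip (L := innerₗ ℝ)
          (μ := volume) (ν := volume) Real.continuous_fourierChar
          continuous_inner gS.integrable hf
        simp only [flip_innerₗ] at this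
        rw [SchwartzMap.fourier_coe]
        exact this
      have i1 : Integrable (fun x => g x • h x) := by
        have := ((Lp.memLp h).locallyIntegrable
          (by norm_num)).integrable_smul_left_of_hasCompactSupport hg.continuous hgc
        exact this
      have i2 : Integrable (fun x => g x • 𝓕 f x) :=
        hcont.locallyIntegrable.integrable_smul_left_of_hasCompactSupport hg.continuous hgc
      simp_rw [smul_sub]
      rw [integral_sub i1 i2, sub_eq_zero]
      rw [e2, e3] at e1
      simp only [hgS, Complex.coe_smul] at e1
      exact e1.symm
    filter_upwards [key] with x hx using sub_eq_zero.1 hx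
  have h1 := MeasureTheory.Lp.norm_fourier_eq (hf2.toLp f)
  rw [Lp.norm_def, Lp.norm_def, eLpNorm_congr_ae hae, eLpNorm_congr_ae hf2.coeFn_toLp] at h1
  have h2 : eLpNorm (𝓕 f) 2 ≠ ⊤ := by
    rw [← eLpNorm_congr_ae hae]
    exact (Lp.memLp _).2.ne
  exact (ENNReal.toReal_eq_toReal_iff' h2 hf2.2.ne).1 h1

theorem integrable_inv_one_add_sq_mul (C : ℝ) : Integrable fun y : ℝ => C / (1 + y ^ 2) := by
  simpa [div_eq_mul_inv] using integrable_inv_one_add_sq.const_mul C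

/-- Shifting the line of integration inside a vertical strip. -/
theorem integral_vertical_line_eq {E : Type*} [NormedAddCommGroup E] [NormedSpace ℂ E]
    [CompleteSpace E] {f : ℂ → E} {a b C : ℝ} (hab : a ≤ b)
    (hd : ∀ z : ℂ, a ≤ z.re → z.re ≤ b → DifferentiableAt ℂ f z)
    (hC : ∀ z : ℂ, a ≤ z.re → z.re ≤ b → ‖f z‖ ≤ C / (1 + z.im ^ 2)) :
    ∫ y : ℝ, f (a + y * Complex.I) = ∫ y : ℝ, f (b + y * Complex.I) := by
  have hint : ∀ c : ℝ, a ≤ c → c ≤ b → Integrable fun y : ℝ => f (c + y * Complex.I) := by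
    intro c hac hcb
    have hc : Continuous fun y : ℝ => f (c + y * Complex.I) := by
      refine continuous_iff_continuousAt.2 fun y => ?_
      refine ContinuousAt.comp (g := f) (f := fun y : ℝ => (c + y * Complex.I : ℂ))
        (hd _ (by simpa) (by simpa)).continuousAt (by fun_prop)
    refine (integrable_inv_one_add_sq_mul C).mono' hc.aestronglyMeasurable (ae_of_all _ fun y => ?_)
    simpa using hC (c + y * Complex.I) (by simpa) (by simpa)
  have hrect : ∀ N : ℝ, 0 ≤ N →
      (∫ y : ℝ in (-N)..N, f (b + y * Complex.I)) - (∫ y : ℝ in (-N)..N, f (a + y * Complex.I)) =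
      Complex.I • ((∫ x : ℝ in a..b, f (x + (-N : ℝ) * Complex.I)) -
        ∫ x : ℝ in a..b, f (x + (N : ℝ) * Complex.I)) := by
    intro N hN
    have := Complex.integral_boundary_rect_eq_zero_of_differentiableOn f
      ⟨a, -N⟩ ⟨b, N⟩ (fun z hz => by
        have hz' := hz.1
        simp only [uIcc_of_le hab, mem_preimage, mem_Icc] at hz'
        exact (hd z hz'.1 hz'.2).differentiableWithinAt)
    simp only at this
    have h2 : Complex.I • ((∫ y : ℝ in (-N)..N, f (b + y * Complex.I)) -
        (∫ y : ℝ in (-N)..N, f (a + y * Complex.I))) =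
        -((∫ x : ℝ in a..b, f (x + (-N : ℝ) * Complex.I)) -
        ∫ x : ℝ in a..b, f (x + (N : ℝ) * Complex.I)) := by
      rw [smul_sub, eq_neg_iff_add_eq_zero, ← this]
      abel
    rw [← neg_neg ((∫ x : ℝ in a..b, f (x + (-N : ℝ) * Complex.I)) -
        ∫ x : ℝ in a..b, f (x + (N : ℝ) * Complex.I)), ← h2, smul_neg, smul_smul]
    simp
  have hbd : ∀ y : ℝ, ‖∫ x : ℝ in a..b, f (x + (y : ℝ) * Complex.I)‖ ≤
      C / (1 + y ^ 2) * (b - a) := by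
    intro y
    have := intervalIntegral.norm_integral_le_of_norm_le_const (a := a) (b := b)
      (f := fun x : ℝ => f (x + (y : ℝ) * Complex.I)) (C := C / (1 + y ^ 2)) (fun x hx => by
        rw [uIoc_of_le hab] at hx
        simpa using hC (x + y * Complex.I) (by simpa using hx.1.le) (by simpa using hx.2))
    rwa [abs_of_nonneg (sub_nonneg.2 hab)] at this
  have hlim : Tendsto (fun y : ℝ => C / (1 + y ^ 2) * (b - a)) atTop (𝓝 0) := by
    have h1 : Tendsto (fun y : ℝ => 1 + y ^ 2) atTop atTop :=
      tendsto_atTop_add_const_left _ _ (tendsto_pow_atTop two_ne_zero)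
    simpa using ((h1.const_div_atTop C).mul_const (b - a))
  have t1 : Tendsto (fun y : ℝ => ∫ x : ℝ in a..b, f (x + (y : ℝ) * Complex.I)) atTop (𝓝 0) :=
    squeeze_zero_norm hbd hlim
  have t2 : Tendsto (fun y : ℝ => ∫ x : ℝ in a..b, f (x + (-y : ℝ) * Complex.I)) atTop (𝓝 0) :=
    squeeze_zero_norm (fun y => by simpa using hbd (-y)) hlim
  have t3 := ((intervalIntegral_tendsto_integral (hint b hab le_rfl) tendsto_neg_atTop_atBot
    tendsto_id).sub (intervalIntegral_tendsto_integral (hint a le_rfl hab) tendsto_neg_atTop_atBot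
    tendsto_id))
  have t4 : Tendsto (fun N : ℝ => (∫ y : ℝ in (-N)..N, f (b + y * Complex.I)) -
      (∫ y : ℝ in (-N)..N, f (a + y * Complex.I))) atTop (𝓝 0) := by
    have : Tendsto (fun N : ℝ => Complex.I • ((∫ x : ℝ in a..b, f (x + (-N : ℝ) * Complex.I)) -
        ∫ x : ℝ in a..b, f (x + (N : ℝ) * Complex.I))) atTop (𝓝 0) := by
      simpa using (t2.sub t1).const_smul Complex.I
    refine this.congr' ?_
    filter_upwards [eventually_ge_atTop 0] with N hN using (hrect N hN).symm
  exact (sub_eq_zero.1 (tendsto_nhds_unique t3 t4)).symm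

/-! ### Resolvent estimates in a commutative Banach algebra -/

/-- A family `R` on the closed right half-plane that satisfies the resolvent identity, grows at most
like `|z|^β`, and decays like `1 / r` on the positive half-line. -/
structure IsPolyResolvent {𝔸 : Type*} [NormedCommRing 𝔸] [NormedAlgebra ℂ 𝔸]
    (R : ℂ → 𝔸) (β C K : ℝ) : Prop where
  sub_eq : ∀ z w : ℂ, 0 ≤ z.re → 0 ≤ w.re → R z - R w = (w - z) • (R z * R w)
  norm_le : ∀ z : ℂ, 0 ≤ z.re → ‖R z‖ ≤ C * (1 + ‖z‖) ^ β
  norm_ofReal_le : ∀ r : ℝ, 0 ≤ r → ‖R r‖ ≤ K / (1 + r)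
  nonneg : 0 ≤ β
  const_nonneg : 0 ≤ C

namespace IsPolyResolvent

variable {𝔸 : Type*} [NormedCommRing 𝔸] [NormedAlgebra ℂ 𝔸] {R : ℂ → 𝔸} {β C K : ℝ}

/-- `1 - μ R(μ)`, which is `-A R(μ, A)` when `R` is the resolvent of `A`. -/
def compl (R : ℂ → 𝔸) (μ : ℝ) : 𝔸 := 1 - (μ : ℂ) • R μ

theorem decay_const_nonneg (h : IsPolyResolvent R β C K) : 0 ≤ K := by
  have := (norm_nonneg _).trans (h.norm_ofReal_le 0 le_rfl)
  simpa using this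

theorem mul_zero_eq (h : IsPolyResolvent R β C K) {z : ℂ} (hz : 0 ≤ z.re) (hz0 : z ≠ 0) :
    R z * R 0 = z⁻¹ • (R 0 - R z) := by
  rw [← neg_sub (R z), h.sub_eq z 0 hz le_rfl, zero_sub, neg_smul, neg_neg, smul_smul,
    inv_mul_cancel₀ hz0, one_smul]

theorem mul_eq (h : IsPolyResolvent R β C K) {z w : ℂ} (hz : 0 ≤ z.re) (hw : 0 ≤ w.re)
    (hzw : w - z ≠ 0) : R z * R w = (w - z)⁻¹ • (R z - R w) := by
  rw [h.sub_eq z w hz hw, smul_smul, inv_mul_cancel₀ hzw, one_smul]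

theorem compl_mul_zero (h : IsPolyResolvent R β C K) {μ : ℝ} (hμ : 0 ≤ μ) :
    compl R μ * R 0 = R μ := by
  have := h.sub_eq μ 0 (by simpa) le_rfl
  rw [zero_sub, neg_smul] at this
  rw [compl, sub_mul, one_mul, smul_mul_assoc, sub_eq_iff_eq_add, ← sub_eq_iff_eq_add', sub_eq_neg_add,
    ← sub_eq_neg_add, ← neg_sub, this, neg_neg]

/-- For a resolvent, `compl R 1` is -A(1 - A)⁻¹, with inverse 1 + (-A)⁻¹. This allows factors `compl
R 1` to be inserted at bounded cost. -/
theorem one_add_zero_mul_compl_one (h : IsPolyResolvent R β C K) :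
    (1 + R 0) * compl R 1 = 1 := by
  rw [add_mul, mul_comm (R 0), h.compl_mul_zero zero_le_one, compl]
  simp

theorem compl_mul (h : IsPolyResolvent R β C K) {μ r : ℝ} (hμ : 0 ≤ μ) (hr : 0 ≤ r) :
    compl R μ * R r = R μ * compl R r := by
  have := h.sub_eq μ r (by simpa) (by simpa)
  simp only [compl]
  linear_combination (norm := algebra) -this

theorem norm_smul_le (h : IsPolyResolvent R β C K) {μ : ℝ} (hμ : 0 ≤ μ) :
    ‖(μ : ℂ) • R μ‖ ≤ K := by
  have h1 := h.norm_ofReal_le μ hμ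
  have hK := h.decay_const_nonneg
  rw [norm_smul, Complex.norm_real, Real.norm_of_nonneg hμ]
  calc μ * ‖R μ‖ ≤ μ * (K / (1 + μ)) := by gcongr
    _ = K * (μ / (1 + μ)) := by ring
    _ ≤ K * 1 := by
        gcongr
        rw [div_le_one (by positivity)]
        linarith
    _ = K := mul_one K

theorem norm_compl_le (h : IsPolyResolvent R β C K) {μ : ℝ} (hμ : 0 ≤ μ) :
    ‖compl R μ‖ ≤ ‖(1 : 𝔸)‖ + K :=
  (norm_sub_le _ _).trans (by gcongr; exact h.norm_smul_le hμ)

/-- Since -A R(μ) R(r) is symmetric in μ and r, the factor -A can be absorbed by either resolvent,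
leaving the decay of the other; the two bounds are added. -/
theorem norm_compl_mul_le (h : IsPolyResolvent R β C K) {μ r : ℝ} (hμ : 0 < μ) (hr : 0 ≤ r) :
    ‖compl R μ * R r‖ ≤ 2 * (‖(1 : 𝔸)‖ + K) * K / (μ + r) := by
  have hK := h.decay_const_nonneg
  set q := ‖(1 : 𝔸)‖ + K
  have hq : 0 ≤ q := by positivity
  have h1 : ‖compl R μ * R r‖ ≤ q * (K / (1 + r)) :=
    (norm_mul_le _ _).trans (mul_le_mul (h.norm_compl_le hμ.le) (h.norm_ofReal_le r hr)
      (norm_nonneg _) hq)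
  have h2 : ‖compl R μ * R r‖ ≤ (K / (1 + μ)) * q := by
    rw [h.compl_mul hμ.le hr]
    exact (norm_mul_le _ _).trans (mul_le_mul (h.norm_ofReal_le μ hμ.le) (h.norm_compl_le hr)
      (norm_nonneg _) (by positivity))
  rw [le_div_iff₀ (by positivity)]
  have h1' : ‖compl R μ * R r‖ * (1 + r) ≤ q * K := by
    calc _ ≤ q * (K / (1 + r)) * (1 + r) := by gcongr
      _ = q * K := by field_simp
  have h2' : ‖compl R μ * R r‖ * (1 + μ) ≤ q * K := by
    calc _ ≤ (K / (1 + μ)) * q * (1 + μ) := by gcongr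
      _ = q * K := by field_simp
  nlinarith [norm_nonneg (compl R μ * R r)]

theorem exists_norm_pow_le_one_add (h : IsPolyResolvent R β C K) (j : ℕ) :
    ∃ c, 0 ≤ c ∧ ∀ z : ℂ, 0 ≤ z.re → ‖R z ^ j‖ ≤ c * (1 + ‖z‖) ^ (j * β) := by
  induction j with
  | zero => exact ⟨‖(1 : 𝔸)‖, norm_nonneg _, by simp⟩
  | succ j ih =>
    obtain ⟨c, hc, hcz⟩ := ih
    have hC := h.const_nonneg
    refine ⟨c * C, by positivity, fun z hz => ?_⟩
    rw [pow_succ]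
    refine (norm_mul_le _ _).trans ((mul_le_mul (hcz z hz) (h.norm_le z hz) (norm_nonneg _)
      (by positivity)).trans_eq ?_)
    push_cast
    rw [add_mul, one_mul, Real.rpow_add (by positivity)]
    ring

theorem exists_norm_pow_le (h : IsPolyResolvent R β C K) (j : ℕ) :
    ∃ c, 0 ≤ c ∧ ∀ (z : ℂ) (x : ℝ), 0 ≤ z.re → 1 ≤ x → ‖z‖ ≤ x → ‖R z ^ j‖ ≤ c * x ^ (j * β) := by
  obtain ⟨c, hc, hcz⟩ := h.exists_norm_pow_le_one_add j
  have hβ := h.nonneg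
  refine ⟨c * 2 ^ (j * β), by positivity, fun z x hz hx hzx => (hcz z hz).trans ?_⟩
  rw [mul_assoc, ← Real.mul_rpow (by positivity) (by positivity)]
  gcongr
  linarith

/-- The integrand bound behind `isNegPowLike_integral`. By induction on j: for r ≥ |z|/2 the decay
of R(r) suffices, while for r ≤ |z|/2 the resolvent identity divides by r - z, of size comparable to
|z|, and removes one of R(z), R(r). -/
theorem exists_norm_pow_mul_compl_mul_le (h : IsPolyResolvent R β C K) (j : ℕ) :
    ∃ c, 0 ≤ c ∧ ∀ (z : ℂ) (μ r : ℝ), 0 ≤ z.re → 1 ≤ ‖z‖ → 0 < μ → 0 ≤ r →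
      ‖R z ^ j * compl R μ * R r‖ ≤ c * (‖z‖ ^ (j * β) / (‖z‖ + r) + 1 / (μ + r)) := by
  have hK := h.decay_const_nonneg
  have hβ := h.nonneg
  set q := ‖(1 : 𝔸)‖ + K
  have hq : 0 ≤ q := by positivity
  induction j with
  | zero =>
    refine ⟨2 * q * K, by positivity, fun z μ r hz hz1 hμ hr => ?_⟩
    rw [pow_zero, one_mul]
    refine (h.norm_compl_mul_le hμ hr).trans ?_
    rw [div_eq_mul_one_div]
    gcongr
    have : 0 ≤ ‖z‖ ^ (((0 : ℕ) : ℝ) * β) / (‖z‖ + r) := by positivity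
    linarith
  | succ j ih =>
    obtain ⟨c, hc, hcz⟩ := ih
    obtain ⟨d, hd, hdz⟩ := h.exists_norm_pow_le (j + 1)
    refine ⟨3 * (d * q * K) + 3 * (d * q) + 2 * c, by positivity, fun z μ r hz hz1 hμ hr => ?_⟩
    have hx : 0 < ‖z‖ := by linarith
    have hpow := hdz z ‖z‖ hz hz1 le_rfl
    have hQ := h.norm_compl_le hμ.le
    set x := ‖z‖
    set b := x ^ (((j + 1 : ℕ) : ℝ) * β)
    have hb : 0 ≤ b := by positivity
    have hdqb : ‖R z ^ (j + 1) * compl R μ‖ ≤ d * b * q :=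
      (norm_mul_le _ _).trans (mul_le_mul hpow hQ (norm_nonneg _) (by positivity))
    have hμr : 0 ≤ 1 / (μ + r) := by positivity
    rcases le_total (x / 2) r with hxr | hxr
    · have h1 : 1 / (1 + r) ≤ 3 / (x + r) := by
        rw [div_le_div_iff₀ (by positivity) (by positivity)]
        linarith
      calc ‖R z ^ (j + 1) * compl R μ * R r‖ ≤ (d * b * q) * (K / (1 + r)) :=
            (norm_mul_le _ _).trans (mul_le_mul hdqb (h.norm_ofReal_le r hr)
              (norm_nonneg _) (by positivity))
        _ = d * q * K * b * (1 / (1 + r)) := by ring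
        _ ≤ d * q * K * b * (3 / (x + r)) := by gcongr
        _ = 3 * (d * q * K) * (b / (x + r)) := by ring
        _ ≤ (3 * (d * q * K) + 3 * (d * q) + 2 * c) * (b / (x + r) + 1 / (μ + r)) := by
            gcongr
            · linarith [mul_nonneg hd hq]
            · linarith
    · have hne : x / 2 ≤ ‖(r : ℂ) - z‖ := by
        have := norm_sub_norm_le z r
        rw [norm_sub_rev, Complex.norm_real, Real.norm_of_nonneg hr] at this
        linarith
      have hne0 : (r : ℂ) - z ≠ 0 := by
        rw [← norm_pos_iff]
        linarith
      have hinv : ‖((r : ℂ) - z)⁻¹‖ ≤ 2 / x := by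
        rw [norm_inv, inv_le_comm₀ (by linarith) (by positivity), inv_div]
        exact hne
      have e : R z ^ (j + 1) * compl R μ * R r =
          ((r : ℂ) - z)⁻¹ • (R z ^ (j + 1) * compl R μ - R z ^ j * compl R μ * R r) := by
        have := h.mul_eq hz (w := r) (by simpa) hne0
        linear_combination (norm := algebra) (R z ^ j * compl R μ) * this
      have h2 : 2 / x ≤ 3 / (x + r) := by
        rw [div_le_div_iff₀ (by positivity) (by positivity)]
        linarith
      have h3 : 2 / x ≤ 2 := by
        rw [div_le_iff₀ hx]
        linarith
      have hbj : x ^ ((j : ℝ) * β) ≤ b := by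
        apply Real.rpow_le_rpow_of_exponent_le hz1
        push_cast
        nlinarith
      rw [e, norm_smul]
      calc ‖((r : ℂ) - z)⁻¹‖ * ‖R z ^ (j + 1) * compl R μ - R z ^ j * compl R μ * R r‖
          ≤ (2 / x) * (d * b * q + c * (x ^ ((j : ℝ) * β) / (x + r) + 1 / (μ + r))) := by
            gcongr
            exact (norm_sub_le _ _).trans (add_le_add hdqb (hcz z μ r hz hz1 hμ hr))
        _ = (d * q) * b * (2 / x) + (2 / x) *
            (c * (x ^ ((j : ℝ) * β) / (x + r) + 1 / (μ + r))) := by ring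
        _ ≤ (d * q) * b * (3 / (x + r)) + 2 * (c * (b / (x + r) + 1 / (μ + r))) := by gcongr
        _ = 3 * (d * q) * (b / (x + r)) + 2 * c * (b / (x + r) + 1 / (μ + r)) := by ring
        _ ≤ (3 * (d * q * K) + 3 * (d * q)) * (b / (x + r) + 1 / (μ + r)) +
            2 * c * (b / (x + r) + 1 / (μ + r)) := by
            gcongr
            · have : 0 ≤ d * q * K := by positivity
              linarith
            · linarith
        _ = _ := by ring

/-- `B` behaves like the fractional power `(-A)^{-θ}` relative to the resolvent `R` of `A`. -/
def IsNegPowLike (R : ℂ → 𝔸) (β : ℝ) (B : 𝔸) (θ : ℝ) : Prop :=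
  ∀ j : ℕ, ∃ c, 0 ≤ c ∧ ∀ (z : ℂ) (μ : ℝ), 0 ≤ z.re → 1 ≤ ‖z‖ → 1 ≤ μ →
    ‖R z ^ j * compl R μ * B‖ ≤ c * (‖z‖ ^ (j * β - θ) + μ ^ (-θ))

theorem isNegPowLike_one (h : IsPolyResolvent R β C K) : IsNegPowLike R β 1 0 := by
  intro j
  obtain ⟨d, hd, hdz⟩ := h.exists_norm_pow_le j
  have hK := h.decay_const_nonneg
  refine ⟨d * (‖(1 : 𝔸)‖ + K), by positivity, fun z μ hz hz1 hμ => ?_⟩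
  rw [mul_one, sub_zero, neg_zero, Real.rpow_zero]
  calc ‖R z ^ j * compl R μ‖ ≤ (d * ‖z‖ ^ (j * β)) * (‖(1 : 𝔸)‖ + K) :=
        (norm_mul_le _ _).trans (mul_le_mul (hdz z ‖z‖ hz hz1 le_rfl)
          (h.norm_compl_le (by linarith)) (norm_nonneg _) (by positivity))
    _ = d * (‖(1 : 𝔸)‖ + K) * ‖z‖ ^ (j * β) := by ring
    _ ≤ _ := by gcongr; linarith

/-- Raises the order from θ to n + θ. From R(μ) = Q R(0), with Q = `compl R μ`, and the identity for
R(z) R(0) one gets R(z) R(μ) = z⁻¹ (R(μ) - Q R(z)). Each use gains z⁻¹ and removes one of R(z),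
R(μ), hence the double induction. -/
theorem exists_norm_pow_mul_pow_mul_compl_mul_le (h : IsPolyResolvent R β C K) {B : 𝔸} {θ : ℝ} (hB : IsNegPowLike R β B θ)
    (n j : ℕ) :
    ∃ c, 0 ≤ c ∧ ∀ (z : ℂ) (μ : ℝ), 0 ≤ z.re → 1 ≤ μ → μ ≤ ‖z‖ →
      ‖R z ^ j * R μ ^ n * compl R μ * B‖ ≤ c * (‖z‖ ^ (j * β - (n + θ)) + μ ^ (-(n + θ))) := by
  have hK := h.decay_const_nonneg
  have hβ := h.nonneg
  set q := ‖(1 : 𝔸)‖ + K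
  have hq : 0 ≤ q := by positivity
  induction n generalizing j with
  | zero =>
    obtain ⟨c, hc, hcz⟩ := hB j
    refine ⟨c, hc, fun z μ hz hμ hμz => ?_⟩
    simpa using hcz z μ hz (hμ.trans hμz) hμ
  | succ n ihn =>
    induction j with
    | zero =>
      obtain ⟨c, hc, hcz⟩ := hB 0
      refine ⟨K ^ (n + 1) * (2 * c), by positivity, fun z μ hz hμ hμz => ?_⟩
      have hμ0 : 0 < μ := by linarith
      have hRμ : ‖R μ‖ ≤ K / μ := (h.norm_ofReal_le μ hμ0.le).trans (by gcongr; linarith)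
      have hone : ‖((μ : ℝ) : ℂ)‖ = μ := by simp [abs_of_pos hμ0]
      -- At z = μ with no factor R(z) both terms of the bound equal μ^(-θ).
      have hb := hcz μ μ (by simpa using hμ0.le) (by rw [hone]; exact hμ) hμ
      rw [hone] at hb
      have hb' : ‖compl R μ * B‖ ≤ 2 * c * μ ^ (-θ) := by
        refine le_trans (by simpa using hb) (le_of_eq ?_)
        ring
      have e : μ ^ (-(((n + 1 : ℕ) : ℝ) + θ)) = μ ^ (-θ) / μ ^ (n + 1) := by
        rw [neg_add_rev, Real.rpow_add hμ0, Real.rpow_neg hμ0.le ((n + 1 : ℕ) : ℝ),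
          Real.rpow_natCast]
        rfl
      calc ‖R z ^ 0 * R μ ^ (n + 1) * compl R μ * B‖
          = ‖R μ ^ (n + 1) * (compl R μ * B)‖ := by rw [pow_zero, one_mul, mul_assoc]
        _ ≤ (K / μ) ^ (n + 1) * (2 * c * μ ^ (-θ)) := by
            refine (norm_mul_le _ _).trans (mul_le_mul ?_ hb' (norm_nonneg _) (by positivity))
            exact (norm_pow_le' _ n.succ_pos).trans (by gcongr)
        _ = K ^ (n + 1) * (2 * c) * μ ^ (-(((n + 1 : ℕ) : ℝ) + θ)) := by
            rw [e, div_pow]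
            ring
        _ ≤ _ := by
            gcongr
            have : 0 ≤ ‖z‖ ^ (((0 : ℕ) : ℝ) * β - (((n + 1 : ℕ) : ℝ) + θ)) := by positivity
            linarith
    | succ j ihj =>
      obtain ⟨c, hc, hcz⟩ := ihj
      obtain ⟨d, hd, hdz⟩ := ihn (j + 1)
      refine ⟨c + q * d, by positivity, fun z μ hz hμ hμz => ?_⟩
      have hμ0 : 0 < μ := by linarith
      have hx : 0 < ‖z‖ := by linarith
      have hz0 : z ≠ 0 := norm_pos_iff.1 hx
      have e : R z ^ (j + 1) * R μ ^ (n + 1) * compl R μ * B =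
          z⁻¹ • (R z ^ j * R μ ^ (n + 1) * compl R μ * B -
            compl R μ * (R z ^ (j + 1) * R μ ^ n * compl R μ * B)) := by
        have h1 := h.mul_zero_eq hz hz0
        have h2 := h.compl_mul_zero hμ0.le
        have h3 : R z ^ (j + 1) * R μ ^ (n + 1) * compl R μ * B =
          (R z * R 0) * (R z ^ j * R μ ^ n * compl R μ * compl R μ * B) := by
            linear_combination (-(R z ^ (j + 1) * R μ ^ n * compl R μ * B)) * h2
        rw [h3, h1, smul_mul_assoc]
        congr 1
        linear_combination (R z ^ j * R μ ^ n * compl R μ * B) * h2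
      have i1 := hcz z μ hz hμ hμz
      have i2 := hdz z μ hz hμ hμz
      set x := ‖z‖
      have x1 : 1 ≤ x := hμ.trans hμz
      set b := x ^ (((j + 1 : ℕ) : ℝ) * β - (((n + 1 : ℕ) : ℝ) + θ)) with hb
      set m := μ ^ (-(((n + 1 : ℕ) : ℝ) + θ)) with hm
      have b1 : x ^ ((j : ℝ) * β - (((n + 1 : ℕ) : ℝ) + θ)) ≤ b := by
        apply Real.rpow_le_rpow_of_exponent_le x1
        push_cast
        nlinarith
      have b2 : x ^ (((j + 1 : ℕ) : ℝ) * β - ((n : ℝ) + θ)) = x * b := by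
        rw [hb]
        nth_rw 2 [← Real.rpow_one x]
        rw [← Real.rpow_add hx]
        congr 1
        push_cast
        ring
      have b3 : μ ^ (-((n : ℝ) + θ)) = μ * m := by
        rw [hm]
        nth_rw 2 [← Real.rpow_one μ]
        rw [← Real.rpow_add hμ0]
        congr 1
        push_cast
        ring
      have hb0 : 0 ≤ b := by positivity
      have hm0 : 0 ≤ m := by positivity
      rw [e, norm_smul, norm_inv, inv_mul_le_iff₀ hx]
      refine (norm_sub_le _ _).trans ?_
      have i3 := (norm_mul_le (compl R μ) (R z ^ (j + 1) * R μ ^ n * compl R μ * B)).trans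
        (mul_le_mul (h.norm_compl_le hμ0.le) i2 (norm_nonneg _) hq)
      rw [b2, b3] at i3
      calc _ ≤ c * (b + m) + q * (d * (x * b + μ * m)) := by
            refine add_le_add (i1.trans ?_) i3
            gcongr
        _ ≤ c * (x * (b + m)) + q * (d * (x * b + x * m)) := by
            gcongr
            exact le_mul_of_one_le_left (by positivity) x1
        _ = _ := by ring

theorem compl_pow_mul_zero_pow (h : IsPolyResolvent R β C K) {μ : ℝ} (hμ : 0 ≤ μ) (n : ℕ) (B : 𝔸) :
    compl R μ ^ (n + 1) * (R 0 ^ n * B) = R μ ^ n * compl R μ * B := by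
  rw [← h.compl_mul_zero hμ, mul_pow]
  ring

/-- The case μ = 1 of the preceding estimate, after writing R(0)^n B as (1 + R(0))^(n+1) times
R(1)^n `compl R 1` B. -/
theorem exists_norm_pow_mul_negPow_le (h : IsPolyResolvent R β C K) {B : 𝔸} {θ δ : ℝ}
    (hB : IsNegPowLike R β B θ) (n j : ℕ) (hδ : 0 ≤ δ)
    (hjδ : j * β - (n + θ) ≤ δ) :
    ∃ c, 0 ≤ c ∧ ∀ (z : ℂ) (x : ℝ), 0 ≤ z.re → 1 ≤ x → ‖z‖ ≤ x →
      ‖R z ^ j * (R 0 ^ n * B)‖ ≤ c * x ^ δ := by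
  obtain ⟨c, hc, hcz⟩ := h.exists_norm_pow_mul_pow_mul_compl_mul_le hB n j
  obtain ⟨d, hd, hdz⟩ := h.exists_norm_pow_le j
  refine ⟨‖(1 + R 0) ^ (n + 1)‖ * (c * 2) + d * ‖R 0 ^ n * B‖, by positivity,
    fun z x hz hx hzx => ?_⟩
  have hxδ : 1 ≤ x ^ δ := Real.one_le_rpow hx hδ
  rcases le_total 1 ‖z‖ with h1 | h1
  · have e : R z ^ j * (R 0 ^ n * B) =
        (1 + R 0) ^ (n + 1) * (R z ^ j * R (1 : ℝ) ^ n * compl R 1 * B) := by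
      have e1 := h.compl_pow_mul_zero_pow zero_le_one n B
      have e2 : (1 + R 0) ^ (n + 1) * compl R 1 ^ (n + 1) = 1 := by
        rw [← mul_pow, h.one_add_zero_mul_compl_one, one_pow]
      linear_combination (-(R z ^ j * R 0 ^ n * B)) * e2 + ((1 + R 0) ^ (n + 1) * R z ^ j) * e1
    have e3 : ‖z‖ ^ (j * β - (n + θ)) ≤ x ^ δ :=
      (Real.rpow_le_rpow_of_exponent_le h1 hjδ).trans
        (Real.rpow_le_rpow (norm_nonneg _) hzx hδ)
    rw [e]
    calc _ ≤ ‖(1 + R 0) ^ (n + 1)‖ * (c * (‖z‖ ^ (j * β - (n + θ)) + 1 ^ (-(n + θ)))) :=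
          (norm_mul_le _ _).trans (by gcongr; exact hcz z 1 hz le_rfl h1)
      _ ≤ ‖(1 + R 0) ^ (n + 1)‖ * (c * (x ^ δ + x ^ δ)) := by
          rw [Real.one_rpow]
          gcongr
      _ = ‖(1 + R 0) ^ (n + 1)‖ * (c * 2) * x ^ δ := by ring
      _ ≤ _ := by
          gcongr
          exact le_add_of_nonneg_right (by positivity)
  · have i1 := hdz z 1 hz le_rfl h1
    rw [Real.one_rpow, mul_one] at i1
    calc _ ≤ d * ‖R 0 ^ n * B‖ := (norm_mul_le _ _).trans (by gcongr)
      _ ≤ (d * ‖R 0 ^ n * B‖) * x ^ δ := le_mul_of_one_le_right (by positivity) hxδ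
      _ ≤ _ := by
          gcongr
          exact le_add_of_nonneg_left (by positivity)

/-- Control of the part above the scale μ: n + 1 factors `compl R μ` turn R(0)^n B into R(μ)^n
`compl R μ` B. For |z| ≥ μ the surplus order gives |z|^(-δ) ≤ μ^(-δ); for |z| ≤ μ the crude bound
μ^(jβ) on R(z)^j is paid for by μ^(-(n+θ)). -/
theorem exists_norm_pow_mul_compl_pow_mul_negPow_le (h : IsPolyResolvent R β C K) {B : 𝔸}
    {θ δ : ℝ} (hB : IsNegPowLike R β B θ) (n j : ℕ) (hδ : 0 ≤ δ)
    (hjδ : j * β + δ ≤ n + θ) :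
    ∃ c, 0 ≤ c ∧ ∀ (z : ℂ) (μ : ℝ), 0 ≤ z.re → 1 ≤ μ →
      ‖R z ^ j * (compl R μ ^ (n + 1) * (R 0 ^ n * B))‖ ≤ c * μ ^ (-δ) := by
  have hβ := h.nonneg
  obtain ⟨c, hc, hcz⟩ := h.exists_norm_pow_mul_pow_mul_compl_mul_le hB n j
  obtain ⟨a, ha, haz⟩ := h.exists_norm_pow_mul_pow_mul_compl_mul_le hB n 0
  obtain ⟨d, hd, hdz⟩ := h.exists_norm_pow_le j
  refine ⟨c * 2 + d * (2 * a), by positivity, fun z μ hz hμ => ?_⟩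
  have hμ0 : 0 < μ := by linarith
  rw [h.compl_pow_mul_zero_pow hμ0.le]
  have hμδ : μ ^ (-((n : ℝ) + θ)) ≤ μ ^ (-δ) :=
    Real.rpow_le_rpow_of_exponent_le hμ (by nlinarith [mul_nonneg (Nat.cast_nonneg (α := ℝ) j) hβ])
  rcases le_total μ ‖z‖ with h1 | h1
  · have e3 : ‖z‖ ^ (j * β - (n + θ)) ≤ μ ^ (-δ) :=
      (Real.rpow_le_rpow_of_exponent_le (hμ.trans h1) (by linarith)).trans
        (Real.rpow_le_rpow_of_nonpos hμ0 h1 (by linarith))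
    calc _ = ‖R z ^ j * R μ ^ n * compl R μ * B‖ := by
          congr 1
          ring
      _ ≤ c * (μ ^ (-δ) + μ ^ (-δ)) := (hcz z μ hz hμ h1).trans (by gcongr)
      _ = c * 2 * μ ^ (-δ) := by ring
      _ ≤ _ := by
          gcongr
          exact le_add_of_nonneg_right (by positivity)
  · have hone : ‖((μ : ℝ) : ℂ)‖ = μ := by simp [abs_of_pos hμ0]
    have i1 := haz μ μ (by simpa using hμ0.le) hμ (by rw [hone])
    rw [pow_zero, one_mul, hone, Nat.cast_zero, zero_mul, zero_sub, ← two_mul] at i1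
    calc _ ≤ (d * μ ^ (j * β)) * (a * (2 * μ ^ (-((n : ℝ) + θ)))) :=
          (norm_mul_le _ _).trans (mul_le_mul (hdz z μ hz hμ h1) i1 (norm_nonneg _)
            (by positivity))
      _ = d * (2 * a) * μ ^ (j * β + -((n : ℝ) + θ)) := by
          rw [Real.rpow_add hμ0]
          ring
      _ ≤ d * (2 * a) * μ ^ (-δ) := by
          refine mul_le_mul_of_nonneg_left (Real.rpow_le_rpow_of_exponent_le hμ ?_) (by positivity)
          linarith
      _ ≤ _ := by
          gcongr
          exact le_add_of_nonneg_left (by positivity)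

/-- Away from the scale, R(z) μR(μ) = (z - μ)⁻¹ (μR(μ) - μR(z)) with |z - μ| ≥ |z|/2. The first term
loses a factor R(z), the second trades a factor μR(μ) for μ/|z|; induction on m and j. -/
theorem exists_norm_pow_mul_smul_pow_mul_negPow_le_of_le (h : IsPolyResolvent R β C K) {B : 𝔸}
    {θ δ : ℝ} (hB : IsNegPowLike R β B θ) (n m j : ℕ) (hδ : 0 ≤ δ)
    (hjδ : j * β - (n + θ) ≤ δ) :
    ∃ c, 0 ≤ c ∧ ∀ (z : ℂ) (μ : ℝ), 0 ≤ z.re → 1 ≤ μ → 2 * μ ≤ ‖z‖ →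
      ‖R z ^ j * (((μ : ℂ) • R μ) ^ m * (R 0 ^ n * B))‖ ≤
        c * ((μ / ‖z‖) ^ m * ‖z‖ ^ δ + 1) := by
  have hβ := h.nonneg
  have hK := h.decay_const_nonneg
  induction m generalizing j with
  | zero =>
    obtain ⟨c, hc, hcz⟩ := h.exists_norm_pow_mul_negPow_le hB n j hδ hjδ
    refine ⟨c, hc, fun z μ hz hμ hμz => ?_⟩
    rw [pow_zero, one_mul, pow_zero, one_mul]
    refine (hcz z ‖z‖ hz (by linarith) le_rfl).trans ?_
    gcongr
    linarith
  | succ m ihm =>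
    induction j with
    | zero =>
      refine ⟨K ^ (m + 1) * ‖R 0 ^ n * B‖, by positivity, fun z μ hz hμ hμz => ?_⟩
      rw [pow_zero, one_mul]
      calc _ ≤ K ^ (m + 1) * ‖R 0 ^ n * B‖ := by
            refine (norm_mul_le _ _).trans ?_
            gcongr
            refine (norm_pow_le' _ m.succ_pos).trans ?_
            gcongr
            exact h.norm_smul_le (by linarith)
        _ ≤ _ := by
            refine le_mul_of_one_le_right (by positivity) ?_
            have : 0 ≤ (μ / ‖z‖) ^ (m + 1) * ‖z‖ ^ δ := by positivity
            linarith
    | succ j ihj =>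
      have hj' : (j : ℝ) * β - (n + θ) ≤ δ := by
        push_cast at hjδ
        nlinarith
      obtain ⟨c, hc, hcz⟩ := ihj hj'
      obtain ⟨d, hd, hdz⟩ := ihm (j + 1) hjδ
      refine ⟨2 * c + 2 * d, by positivity, fun z μ hz hμ hμz => ?_⟩
      have hμ0 : 0 < μ := by linarith
      have hx : 0 < ‖z‖ := by linarith
      have hne : ‖z‖ / 2 ≤ ‖z - μ‖ := by
        have := norm_sub_norm_le z μ
        rw [Complex.norm_real, Real.norm_of_nonneg hμ0.le] at this
        linarith
      have hne0 : z - (μ : ℂ) ≠ 0 := by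
        rw [← norm_pos_iff]
        linarith
      have hinv : ‖(z - (μ : ℂ))⁻¹‖ ≤ 2 / ‖z‖ := by
        rw [norm_inv, inv_le_comm₀ (by linarith) (by positivity), inv_div]
        exact hne
      have e : R z ^ (j + 1) * (((μ : ℂ) • R μ) ^ (m + 1) * (R 0 ^ n * B)) =
          (z - (μ : ℂ))⁻¹ • (R z ^ j * (((μ : ℂ) • R μ) ^ (m + 1) * (R 0 ^ n * B)) -
            (μ : ℂ) • (R z ^ (j + 1) * (((μ : ℂ) • R μ) ^ m * (R 0 ^ n * B)))) := by
        have e1 := h.mul_eq (z := μ) (by simpa using hμ0.le) hz hne0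
        have e2 : ((μ : ℂ) • R μ) * R z = (z - (μ : ℂ))⁻¹ • (((μ : ℂ) • R μ) - (μ : ℂ) • R z) := by
          rw [smul_mul_assoc, e1, smul_comm, smul_sub]
        have e3 : R z ^ (j + 1) * (((μ : ℂ) • R μ) ^ (m + 1) * (R 0 ^ n * B)) =
            (((μ : ℂ) • R μ) * R z) * (R z ^ j * (((μ : ℂ) • R μ) ^ m * (R 0 ^ n * B))) := by
          ring
        rw [e3, e2, smul_mul_assoc, sub_mul, smul_mul_assoc (μ : ℂ) (R z)]
        congr 2
        · ring
        · congr 1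
          ring
      have i1 := hcz z μ hz hμ hμz
      have i2 := hdz z μ hz hμ hμz
      rw [e, norm_smul]
      set x := ‖z‖
      set b := (μ / x) ^ m * x ^ δ
      have hb : 0 ≤ b := by positivity
      have e4 : (μ / x) ^ (m + 1) * x ^ δ = (μ / x) * b := by
        simp only [b]
        ring
      rw [e4] at i1 ⊢
      have i3 : ‖(μ : ℂ) • (R z ^ (j + 1) * (((μ : ℂ) • R μ) ^ m * (R 0 ^ n * B)))‖ ≤
          μ * (d * (b + 1)) := by
        rw [norm_smul, Complex.norm_real, Real.norm_of_nonneg hμ0.le]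
        gcongr
      have hx2 : 2 / x ≤ 2 := by
        rw [div_le_iff₀ hx]
        linarith
      have hμx : 2 * (μ / x) ≤ 1 := by
        rw [mul_div_assoc', div_le_one hx]
        exact hμz
      calc _ ≤ (2 / x) * (c * (μ / x * b + 1) + μ * (d * (b + 1))) := by
            gcongr
            exact (norm_sub_le _ _).trans (add_le_add i1 i3)
        _ = (2 / x) * (c * (μ / x * b + 1)) + (d * 2) * (μ / x * b) + d * (2 * (μ / x)) := by ring
        _ ≤ 2 * (c * (μ / x * b + 1)) + (d * 2) * (μ / x * b) + d * 2 := by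
            gcongr
            linarith
        _ = _ := by ring

/-- Control of the part below the scale μ: m ≥ δ cutoffs μR(μ) suffice to replace the growth |z|^δ
by μ^δ when |z| ≥ 2μ, and for smaller |z| nothing has to be gained. -/
theorem exists_norm_pow_mul_smul_pow_mul_negPow_le (h : IsPolyResolvent R β C K) {B : 𝔸}
    {θ δ : ℝ} (hB : IsNegPowLike R β B θ) (n m j : ℕ) (hδ : 0 ≤ δ) (hm : δ ≤ m)
    (hjδ : j * β - (n + θ) ≤ δ) :
    ∃ c, 0 ≤ c ∧ ∀ (z : ℂ) (μ : ℝ), 0 ≤ z.re → 1 ≤ μ →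
      ‖R z ^ j * (((μ : ℂ) • R μ) ^ m * (R 0 ^ n * B))‖ ≤ c * μ ^ δ := by
  have hK := h.decay_const_nonneg
  obtain ⟨c, hc, hcz⟩ := h.exists_norm_pow_mul_smul_pow_mul_negPow_le_of_le hB n m j hδ hjδ
  obtain ⟨d, hd, hdz⟩ := h.exists_norm_pow_mul_negPow_le hB n j hδ hjδ
  have hPm : ∃ k, 0 ≤ k ∧ ∀ μ : ℝ, 0 ≤ μ → ‖((μ : ℂ) • R μ) ^ m‖ ≤ k := by
    rcases m.eq_zero_or_pos with rfl | hm0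
    · exact ⟨‖(1 : 𝔸)‖, norm_nonneg _, by simp⟩
    · refine ⟨K ^ m, by positivity, fun μ hμ => (norm_pow_le' _ hm0).trans ?_⟩
      gcongr
      exact h.norm_smul_le hμ
  obtain ⟨k, hk, hkμ⟩ := hPm
  refine ⟨c * 2 + k * (d * 2 ^ δ), by positivity, fun z μ hz hμ => ?_⟩
  have hμ0 : 0 < μ := by linarith
  have hμδ : 1 ≤ μ ^ δ := Real.one_le_rpow hμ hδ
  rcases le_total (2 * μ) ‖z‖ with h1 | h1
  · have hx : 0 < ‖z‖ := by linarith
    have i1 : (μ / ‖z‖) ^ m * ‖z‖ ^ δ ≤ μ ^ δ := by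
      calc (μ / ‖z‖) ^ m * ‖z‖ ^ δ = (μ / ‖z‖) ^ (m : ℝ) * ‖z‖ ^ δ := by rw [Real.rpow_natCast]
        _ ≤ (μ / ‖z‖) ^ δ * ‖z‖ ^ δ := by
            gcongr ?_ * _
            refine Real.rpow_le_rpow_of_exponent_ge (by positivity) ?_ hm
            rw [div_le_one hx]
            linarith
        _ = μ ^ δ := by
            rw [← Real.mul_rpow (by positivity) (by positivity), div_mul_cancel₀ _ hx.ne']
    calc _ ≤ c * (μ ^ δ + μ ^ δ) := (hcz z μ hz hμ h1).trans (by gcongr)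
      _ = c * 2 * μ ^ δ := by ring
      _ ≤ _ := by
          gcongr
          exact le_add_of_nonneg_right (by positivity)
  · have i1 := hdz z (2 * μ) hz (by linarith) h1
    rw [Real.mul_rpow (by norm_num) hμ0.le] at i1
    calc _ = ‖((μ : ℂ) • R μ) ^ m * (R z ^ j * (R 0 ^ n * B))‖ := by
          congr 1
          ring
      _ ≤ k * (d * (2 ^ δ * μ ^ δ)) :=
          (norm_mul_le _ _).trans (mul_le_mul (hkμ μ hμ0.le) i1 (norm_nonneg _) hk)
      _ = k * (d * 2 ^ δ) * μ ^ δ := by ring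
      _ ≤ _ := by
          gcongr
          exact le_add_of_nonneg_left (by positivity)

open Polynomial in
theorem exists_norm_aeval_le (p : ℂ[X]) (K : ℝ) :
    ∃ c, 0 ≤ c ∧ ∀ a : 𝔸, ‖a‖ ≤ K → ‖aeval a p‖ ≤ c := by
  induction p using Polynomial.induction_on' with
  | add p q hp hq =>
    obtain ⟨c, hc, hcp⟩ := hp
    obtain ⟨d, hd, hdq⟩ := hq
    refine ⟨c + d, by positivity, fun a ha => ?_⟩
    rw [map_add]
    exact (norm_add_le _ _).trans (add_le_add (hcp a ha) (hdq a ha))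
  | monomial n k =>
    refine ⟨‖k‖ * (‖(1 : 𝔸)‖ + |K| ^ n), by positivity, fun a ha => ?_⟩
    rw [aeval_monomial, ← Algebra.smul_def, norm_smul]
    gcongr
    rcases n.eq_zero_or_pos with rfl | hn
    · simp
    · calc ‖a ^ n‖ ≤ ‖a‖ ^ n := norm_pow_le' _ hn
        _ ≤ |K| ^ n := by
            gcongr
            exact ha.trans (le_abs_self K)
        _ ≤ _ := by linarith [norm_nonneg (1 : 𝔸)]

open Polynomial in
/-- Splitting of `(-A)^{-α}`, `α = n + θ`, at the scale `μ`. -/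
theorem exists_negPow_eq_add (h : IsPolyResolvent R β C K) {B : 𝔸} {θ δ δ' : ℝ}
    (hB : IsNegPowLike R β B θ) (n k : ℕ) (hδ : 0 ≤ δ) (hδ' : 0 ≤ δ')
    (h1 : (k + 1) * β + δ ≤ n + θ) (h2 : (k + 2) * β - (n + θ) ≤ δ') :
    ∃ c, 0 ≤ c ∧ ∀ μ : ℝ, 1 ≤ μ → ∃ D E : 𝔸, D + E = R 0 ^ n * B ∧
      ∀ z : ℂ, 0 ≤ z.re → ‖R z ^ k * D‖ ≤ c * μ ^ (-δ) ∧ ‖R z ^ (k + 1) * D‖ ≤ c * μ ^ (-δ) ∧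
        ‖R z ^ (k + 1) * E‖ ≤ c * μ ^ δ' ∧ ‖R z ^ (k + 2) * E‖ ≤ c * μ ^ δ' := by
  have hβ := h.nonneg
  obtain ⟨m, hm⟩ := exists_nat_ge δ'
  -- Bézout for X^m and (1 - X)^(n+1), evaluated at X = μR(μ), gives a partition of unity whose
  -- coefficients u(P), v(P) are bounded uniformly in μ.
  have hcop : IsCoprime ((X : ℂ[X]) ^ m) ((1 - X) ^ (n + 1)) :=
    IsCoprime.pow ⟨1, 1, by ring⟩
  obtain ⟨u, v, huv⟩ := hcop
  obtain ⟨cu, hcu, hu⟩ := exists_norm_aeval_le (𝔸 := 𝔸) u K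
  obtain ⟨cv, hcv, hv⟩ := exists_norm_aeval_le (𝔸 := 𝔸) v K
  obtain ⟨c1, hc1, hz1⟩ := h.exists_norm_pow_mul_compl_pow_mul_negPow_le hB n k hδ
    (by nlinarith)
  obtain ⟨c2, hc2, hz2⟩ := h.exists_norm_pow_mul_compl_pow_mul_negPow_le hB n (k + 1) hδ
    (by push_cast; linarith)
  obtain ⟨c3, hc3, hz3⟩ := h.exists_norm_pow_mul_smul_pow_mul_negPow_le hB n m (k + 1) hδ' hm
    (by push_cast; nlinarith)
  obtain ⟨c4, hc4, hz4⟩ := h.exists_norm_pow_mul_smul_pow_mul_negPow_le hB n m (k + 2) hδ' hm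
    (by push_cast; linarith)
  have mono : ∀ {a b c x : ℝ}, 0 ≤ b → 0 ≤ x → a ≤ b * x → b ≤ c → a ≤ c * x :=
    fun _ hx hab hbc => hab.trans (mul_le_mul_of_nonneg_right hbc hx)
  refine ⟨cv * c1 + cv * c2 + cu * c3 + cu * c4, by positivity, fun μ hμ => ?_⟩
  have hμ0 : 0 < μ := by linarith
  have hP := h.norm_smul_le hμ0.le
  set P := (μ : ℂ) • R μ
  have hQ : compl R μ = 1 - P := rfl
  have hPQ : aeval P u * P ^ m + aeval P v * compl R μ ^ (n + 1) = 1 := by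
    have := congrArg (aeval P) huv
    simpa [hQ] using this
  have p1 := mul_nonneg hcv hc1
  have p2 := mul_nonneg hcv hc2
  have p3 := mul_nonneg hcu hc3
  have p4 := mul_nonneg hcu hc4
  have key : ∀ {a b : 𝔸} {e c x : ℝ}, ‖a‖ ≤ e → 0 ≤ e → ‖b‖ ≤ c * x → ‖a * b‖ ≤ e * c * x := by
    intro a b e c x ha he hb
    rw [mul_assoc]
    exact (norm_mul_le _ _).trans (mul_le_mul ha hb (norm_nonneg _) he)
  refine ⟨aeval P v * (compl R μ ^ (n + 1) * (R 0 ^ n * B)), aeval P u * (P ^ m * (R 0 ^ n * B)),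
    by linear_combination (R 0 ^ n * B) * hPQ, fun z hz => ?_⟩
  refine ⟨mono p1 (by positivity) ?_ (by linarith), mono p2 (by positivity) ?_ (by linarith),
    mono p3 (by positivity) ?_ (by linarith), mono p4 (by positivity) ?_ (by linarith)⟩
  · rw [mul_left_comm]
    exact key (hv P hP) hcv (hz1 z μ hz hμ)
  · rw [mul_left_comm]
    exact key (hv P hP) hcv (hz2 z μ hz hμ)
  · rw [mul_left_comm]
    exact key (hu P hP) hcu (hz3 z μ hz hμ)
  · rw [mul_left_comm]
    exact key (hu P hP) hcu (hz4 z μ hz hμ)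

end IsPolyResolvent

/-! ### Balakrishnan integrals -/

theorem integrableOn_rpow_neg_div_add {θ ρ : ℝ} (h0 : 0 < θ) (h1 : θ < 1) (hρ : 0 < ρ) :
    IntegrableOn (fun r : ℝ => r ^ (-θ) / (ρ + r)) (Ioi 0) := by
  have hc : ContinuousOn (fun r : ℝ => r ^ (-θ) / (ρ + r)) (Ioi 0) := by
    intro r hr
    have hr' : (0 : ℝ) < r := hr
    exact ((Real.continuousAt_rpow_const r _ (Or.inl hr'.ne')).div (by fun_prop)
      (by positivity)).continuousWithinAt
  rw [← Ioc_union_Ioi_eq_Ioi (zero_le_one (α := ℝ))]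
  refine IntegrableOn.union ?_ ?_
  · have i1 : IntegrableOn (fun r : ℝ => r ^ (-θ) * ρ⁻¹) (Ioc 0 1) := by
      rw [← intervalIntegrable_iff_integrableOn_Ioc_of_le zero_le_one]
      exact (intervalIntegral.intervalIntegrable_rpow' (by linarith)).mul_const _
    refine i1.mono' ((hc.mono Ioc_subset_Ioi_self).aestronglyMeasurable measurableSet_Ioc) ?_
    filter_upwards [ae_restrict_mem measurableSet_Ioc] with r hr
    have hr' : (0 : ℝ) < r := hr.1
    rw [Real.norm_of_nonneg (by positivity), div_eq_mul_inv]
    gcongr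
    linarith
  · have i1 : IntegrableOn (fun r : ℝ => r ^ (-θ - 1)) (Ioi 1) :=
      integrableOn_Ioi_rpow_of_lt (by linarith) one_pos
    refine i1.mono' ((hc.mono (Ioi_subset_Ioi zero_le_one)).aestronglyMeasurable
      measurableSet_Ioi) ?_
    filter_upwards [ae_restrict_mem measurableSet_Ioi] with r hr
    have hr' : (0 : ℝ) < r := one_pos.trans hr
    rw [Real.norm_of_nonneg (by positivity), Real.rpow_sub_one hr'.ne']
    gcongr
    linarith

theorem integral_rpow_neg_div_add {θ ρ : ℝ} (hρ : 0 < ρ) :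
    ∫ r in Ioi (0 : ℝ), r ^ (-θ) / (ρ + r) =
      ρ ^ (-θ) * ∫ r in Ioi (0 : ℝ), r ^ (-θ) / (1 + r) := by
  have h := integral_comp_mul_left_Ioi (fun r : ℝ => r ^ (-θ) / (ρ + r)) 0 hρ
  rw [mul_zero, smul_eq_mul, eq_comm, inv_mul_eq_iff_eq_mul₀ hρ.ne'] at h
  rw [h, ← integral_const_mul, ← integral_const_mul]
  refine setIntegral_congr_fun measurableSet_Ioi fun r hr => ?_
  have hr' : (0 : ℝ) < r := hr
  rw [Real.mul_rpow hρ.le hr'.le]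
  field_simp

theorem integral_rpow_smul_comp_mul {E : Type*} [NormedAddCommGroup E] [NormedSpace ℝ E] (f : ℝ → E)
    (θ : ℝ) {r : ℝ} (hr : 0 < r) : ∫ u in Ioi (0 : ℝ), u ^ (-(1 - θ)) • f (u * r) =
      r ^ (-θ) • ∫ s in Ioi (0 : ℝ), s ^ (-(1 - θ)) • f s := by
  have := integral_comp_mul_right_Ioi (fun s : ℝ => s ^ (-(1 - θ)) • f s) 0 hr
  rw [zero_mul] at this
  have e2 : ∫ u in Ioi (0 : ℝ), (u * r) ^ (-(1 - θ)) • f (u * r) =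
      r ^ (-(1 - θ)) • ∫ u in Ioi (0 : ℝ), u ^ (-(1 - θ)) • f (u * r) := by
    rw [← integral_smul]
    refine setIntegral_congr_fun measurableSet_Ioi fun u hu => ?_
    rw [Real.mul_rpow (le_of_lt hu) hr.le, smul_smul, mul_comm]
  rw [e2, ← eq_inv_smul_iff₀ (by positivity), smul_smul] at this
  rw [this]
  congr 1
  rw [← Real.rpow_neg_one r, ← Real.rpow_neg hr.le, ← Real.rpow_add hr]
  congr 1
  ring

namespace IsPolyResolvent

variable {𝔸 : Type*} [NormedCommRing 𝔸] [NormedAlgebra ℂ 𝔸] {R : ℂ → 𝔸} {β C K : ℝ}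

theorem continuousOn_ofReal (h : IsPolyResolvent R β C K) :
    ContinuousOn (fun r : ℝ => R r) (Ici 0) := by
  have hK := h.decay_const_nonneg
  have hb : ∀ r : ℝ, 0 ≤ r → ‖R r‖ ≤ K := fun r hr => (h.norm_ofReal_le r hr).trans
    (div_le_self hK (by linarith))
  refine LipschitzOnWith.continuousOn (K := (K * K).toNNReal) ?_
  refine LipschitzOnWith.of_dist_le_mul fun r hr s hs => ?_
  have hr' : (0 : ℝ) ≤ r := hr
  have hs' : (0 : ℝ) ≤ s := hs
  rw [dist_eq_norm, h.sub_eq r s (by simpa) (by simpa), norm_smul, Real.coe_toNNReal _ (by positivity),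
    dist_comm, Real.dist_eq, ← Complex.ofReal_sub, Complex.norm_real, Real.norm_eq_abs, mul_comm]
  gcongr
  exact (norm_mul_le _ _).trans (mul_le_mul (hb r hr') (hb s hs') (norm_nonneg _) hK)

theorem continuousOn_rpow_smul (h : IsPolyResolvent R β C K) (a : ℝ) :
    ContinuousOn (fun r : ℝ => r ^ a • R r) (Ioi 0) := by
  refine ContinuousOn.smul (f := fun r : ℝ => r ^ a) (fun r hr => ?_)
    (h.continuousOn_ofReal.mono Ioi_subset_Ici_self)
  exact (Real.continuousAt_rpow_const r _ (Or.inl (ne_of_gt hr))).continuousWithinAt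

theorem integrableOn_rpow_smul (h : IsPolyResolvent R β C K) {θ : ℝ} (h0 : 0 < θ) (h1 : θ < 1) :
    IntegrableOn (fun r : ℝ => r ^ (-θ) • R r) (Ioi 0) := by
  refine ((integrableOn_rpow_neg_div_add h0 h1 one_pos).const_mul K).mono'
    ((h.continuousOn_rpow_smul _).aestronglyMeasurable measurableSet_Ioi) ?_
  filter_upwards [ae_restrict_mem measurableSet_Ioi] with r hr
  have hr' : (0 : ℝ) < r := hr
  rw [norm_smul, Real.norm_of_nonneg (by positivity)]
  calc _ ≤ r ^ (-θ) * (K / (1 + r)) := by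
        gcongr
        exact h.norm_ofReal_le r hr'.le
    _ = _ := by ring

/-- Integrates the bound of `exists_norm_pow_mul_compl_mul_le` against r^(-θ); by scaling, a kernel
1/(ρ + r) contributes ρ^(-θ), with ρ = |z| and ρ = μ. -/
theorem isNegPowLike_integral [CompleteSpace 𝔸] (h : IsPolyResolvent R β C K) {θ : ℝ}
    (h0 : 0 < θ) (h1 : θ < 1) (c : ℝ) :
    IsNegPowLike R β (c • ∫ r in Ioi (0 : ℝ), r ^ (-θ) • R r) θ := by
  intro j
  obtain ⟨d, hd, hdz⟩ := h.exists_norm_pow_mul_compl_mul_le j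
  set κ := ∫ r in Ioi (0 : ℝ), r ^ (-θ) / (1 + r)
  have hκ : 0 ≤ κ := setIntegral_nonneg measurableSet_Ioi fun r hr => by
    have hr' : (0 : ℝ) < r := hr
    positivity
  refine ⟨|c| * d * κ, by positivity, fun z μ hz hz1 hμ => ?_⟩
  have hμ0 : 0 < μ := by linarith
  have hx0 : 0 < ‖z‖ := by linarith
  rw [mul_smul_comm, norm_smul, Real.norm_eq_abs, mul_assoc |c|, mul_assoc |c|]
  gcongr
  rw [← integral_const_mul_of_integrable (h.integrableOn_rpow_smul h0 h1)]
  have hi1 := (integrableOn_rpow_neg_div_add h0 h1 hx0).const_mul (‖z‖ ^ (j * β))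
  have hi2 := integrableOn_rpow_neg_div_add h0 h1 hμ0
  have e : ∫ r in Ioi (0 : ℝ), d * (‖z‖ ^ (j * β) * (r ^ (-θ) / (‖z‖ + r)) + r ^ (-θ) / (μ + r)) =
      d * κ * (‖z‖ ^ (j * β - θ) + μ ^ (-θ)) := by
    rw [integral_const_mul, integral_add hi1 hi2, integral_const_mul,
      integral_rpow_neg_div_add hx0, integral_rpow_neg_div_add hμ0, sub_eq_add_neg,
      Real.rpow_add hx0]
    ring
  rw [← e]
  refine norm_integral_le_of_norm_le ((hi1.add hi2).const_mul d) ?_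
  filter_upwards [ae_restrict_mem measurableSet_Ioi] with r hr
  have hr' : (0 : ℝ) < r := hr
  rw [mul_smul_comm, norm_smul, Real.norm_of_nonneg (by positivity)]
  calc _ ≤ r ^ (-θ) * (d * (‖z‖ ^ (j * β) / (‖z‖ + r) + 1 / (μ + r))) := by
        gcongr
        exact hdz z μ r hz hz1 hμ0 hr'.le
    _ = _ := by ring

theorem tendsto_ofReal_atTop (h : IsPolyResolvent R β C K) :
    Tendsto (fun r : ℝ => R r) atTop (𝓝 0) := by
  refine squeeze_zero_norm' (a := fun r : ℝ => K / (1 + r)) ?_ ?_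
  · filter_upwards [eventually_ge_atTop 0] with r hr using h.norm_ofReal_le r hr
  · exact (tendsto_atTop_add_const_left _ _ tendsto_id).const_div_atTop K

theorem integrableOn_mul_comp_mul (h : IsPolyResolvent R β C K) {u : ℝ} (hu : 0 < u) :
    IntegrableOn (fun r : ℝ => R r * R ((u * r : ℝ) : ℂ)) (Ioi 0) := by
  have hK := h.decay_const_nonneg
  set m := min 1 u
  have hm : 0 < m := lt_min one_pos hu
  have hc : ContinuousOn (fun r : ℝ => R r * R ((u * r : ℝ) : ℂ)) (Ici 0) := by
    refine h.continuousOn_ofReal.mul ?_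
    refine h.continuousOn_ofReal.comp (f := fun r => u * r) (by fun_prop) fun r hr => ?_
    exact mul_nonneg hu.le hr
  refine (integrable_inv_one_add_sq_mul (K * (K * m⁻¹))).restrict.mono'
    ((hc.mono Ioi_subset_Ici_self).aestronglyMeasurable measurableSet_Ioi) ?_
  filter_upwards [ae_restrict_mem measurableSet_Ioi] with r hr
  have hr' : (0 : ℝ) < r := hr
  have hm1 : m ≤ 1 := min_le_left _ _
  have hmu : m ≤ u := min_le_right _ _
  calc _ ≤ (K / (1 + r)) * (K / (1 + u * r)) :=
        (norm_mul_le _ _).trans (mul_le_mul (h.norm_ofReal_le r hr'.le)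
          (h.norm_ofReal_le _ (by positivity)) (norm_nonneg _) (by positivity))
    _ ≤ (K / (1 + r)) * (K / (m * (1 + r))) := by
        gcongr
        nlinarith
    _ = K * (K * m⁻¹) / ((1 + r) * (1 + r)) := by field_simp
    _ ≤ _ := by
        gcongr
        nlinarith

/-- By the resolvent identity the integrand is (R(r) - R(ur)) / ((u - 1) r), a Frullani integral
with limits R(0) at 0 and 0 at infinity. -/
theorem integral_mul_comp_mul [CompleteSpace 𝔸] (h : IsPolyResolvent R β C K) {u : ℝ}
    (hu : 0 < u) (hu1 : u ≠ 1) :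
    ∫ r in Ioi (0 : ℝ), R r * R ((u * r : ℝ) : ℂ) = (Real.log u / (u - 1)) • R 0 := by
  have hu1' : u - 1 ≠ 0 := sub_ne_zero.2 hu1
  have e : EqOn (fun r : ℝ => r⁻¹ • (R ((1 * r : ℝ) : ℂ) - R ((u * r : ℝ) : ℂ)))
      (fun r : ℝ => (u - 1) • (R r * R ((u * r : ℝ) : ℂ))) (Ioi 0) := by
    intro r hr
    have hr' : (0 : ℝ) < r := hr
    beta_reduce
    rw [one_mul, h.sub_eq r (u * r : ℝ) (by simpa using hr'.le) (by
      rw [Complex.ofReal_re]; positivity), ← Complex.ofReal_sub, Complex.coe_smul, smul_smul]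
    congr 1
    field_simp
  have hF := Frullani.integral_Ioi_eq (f := fun r : ℝ => R r) (L := R 0) (R := 0)
    ((h.continuousOn_ofReal.mono Ioi_subset_Ici_self).locallyIntegrableOn measurableSet_Ioi)
    one_pos hu (by
      have := (h.continuousOn_ofReal 0 self_mem_Ici).mono Ioi_subset_Ici_self
      simpa using this.tendsto)
    h.tendsto_ofReal_atTop
    (IntegrableOn.congr_fun (Integrable.smul (u - 1) (h.integrableOn_mul_comp_mul hu)) e.symm
      measurableSet_Ioi)
  rw [setIntegral_congr_fun measurableSet_Ioi e, integral_smul, div_one, sub_zero] at hF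
  rw [div_eq_inv_mul, mul_smul, ← hF, smul_smul, inv_mul_cancel₀ hu1', one_smul]

/-- Complementary Balakrishnan integrals multiply to a nonzero multiple of the inverse. -/
theorem exists_integral_mul_integral_eq_smul [CompleteSpace 𝔸] (h : IsPolyResolvent R β C K)
    {θ : ℝ} (h0 : 0 < θ) (h1 : θ < 1) :
    ∃ c : ℝ, c ≠ 0 ∧ (∫ r in Ioi (0 : ℝ), r ^ (-(1 - θ)) • R r) *
      (∫ r in Ioi (0 : ℝ), r ^ (-θ) • R r) = c • R 0 := by
  set I₂ := ∫ r in Ioi (0 : ℝ), r ^ (-(1 - θ)) • R r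
  have hi1 := h.integrableOn_rpow_smul h0 h1
  have hi2 := h.integrableOn_rpow_smul (θ := 1 - θ) (by linarith) (by linarith)
  -- The substitution s = ur in the other integral turns the product into a double integral of F;
  -- exchanging the order makes the inner integral in r the Frullani one.
  set F : ℝ × ℝ → 𝔸 := fun p => p.2 ^ (-(1 - θ)) • (R p.1 * R ((p.2 * p.1 : ℝ) : ℂ))
  have hFc : ContinuousOn F (Ioi 0 ×ˢ Ioi 0) := by
    refine ContinuousOn.smul (f := fun p : ℝ × ℝ => p.2 ^ (-(1 - θ))) (fun p hp => ?_)
      (ContinuousOn.mul ?_ ?_)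
    · have hp2 : (0 : ℝ) < p.2 := hp.2
      exact ((Real.continuousAt_rpow_const p.2 _ (Or.inl hp2.ne')).comp
        continuous_snd.continuousAt).continuousWithinAt
    · exact h.continuousOn_ofReal.comp continuous_fst.continuousOn fun p hp => (le_of_lt hp.1 : (0 : ℝ) ≤ p.1)
    · exact h.continuousOn_ofReal.comp (f := fun p : ℝ × ℝ => p.2 * p.1) (by fun_prop)
        fun p hp => (le_of_lt (mul_pos hp.2 hp.1) : (0 : ℝ) ≤ p.2 * p.1)
  have hFm : AEStronglyMeasurable F
      ((volume.restrict (Ioi (0 : ℝ))).prod (volume.restrict (Ioi (0 : ℝ)))) := by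
    rw [Measure.prod_restrict]
    exact hFc.aestronglyMeasurable (measurableSet_Ioi.prod measurableSet_Ioi)
  have inner_int : ∀ r : ℝ, 0 < r →
      IntegrableOn (fun u : ℝ => u ^ (-(1 - θ)) • R ((u * r : ℝ) : ℂ)) (Ioi 0) := by
    intro r hr
    have := (integrableOn_Ioi_comp_mul_right_iff (fun s : ℝ => s ^ (-(1 - θ)) • R s) 0 hr).2
      (by rwa [zero_mul])
    refine IntegrableOn.congr_fun (this.smul ((r ^ (-(1 - θ)))⁻¹)) (fun u hu => ?_)
      measurableSet_Ioi
    have : r ^ (-(1 - θ)) ≠ 0 := by positivity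
    simp only [Pi.smul_apply]
    rw [Real.mul_rpow (le_of_lt hu) hr.le, smul_smul, mul_comm (u ^ _), inv_mul_cancel_left₀ this]
  have hF : Integrable F
      ((volume.restrict (Ioi (0 : ℝ))).prod (volume.restrict (Ioi (0 : ℝ)))) := by
    rw [integrable_prod_iff hFm]
    constructor
    · filter_upwards [ae_restrict_mem measurableSet_Ioi] with r hr
      refine IntegrableOn.congr_fun ((inner_int r hr).const_mul (R r)) (fun u hu => ?_)
        measurableSet_Ioi
      simp only [F, mul_smul_comm]
    · have i3 := (hi1.norm).mul_const (∫ s in Ioi (0 : ℝ), s ^ (-(1 - θ)) • ‖R s‖)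
      refine Integrable.mono' i3 ?_ ?_
      · exact hFm.norm.integral_prod_right'
      filter_upwards [ae_restrict_mem measurableSet_Ioi] with r hr
      have hr' : (0 : ℝ) < r := hr
      rw [Real.norm_of_nonneg (integral_nonneg fun _ => norm_nonneg _), norm_smul,
        Real.norm_of_nonneg (by positivity : 0 ≤ r ^ (-θ))]
      have e3 := integral_rpow_smul_comp_mul (fun s : ℝ => ‖R s‖) θ hr'
      rw [smul_eq_mul] at e3
      rw [mul_assoc, mul_left_comm, ← e3, ← integral_const_mul]
      refine integral_mono_of_nonneg (ae_of_all _ fun _ => norm_nonneg _) ?_ ?_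
      · refine Integrable.const_mul ?_ _
        refine IntegrableOn.congr_fun ((inner_int r hr').norm) (fun u hu => ?_) measurableSet_Ioi
        have hu' : (0 : ℝ) < u := hu
        rw [norm_smul, Real.norm_of_nonneg (by positivity), smul_eq_mul]
      · filter_upwards [ae_restrict_mem measurableSet_Ioi] with u hu
        have hu' : (0 : ℝ) < u := hu
        simp only [F]
        rw [norm_smul, Real.norm_of_nonneg (by positivity), smul_eq_mul, mul_left_comm]
        gcongr
        exact norm_mul_le _ _
  have e1 : I₂ * (∫ r in Ioi (0 : ℝ), r ^ (-θ) • R r) =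
      ∫ r in Ioi (0 : ℝ), ∫ u in Ioi (0 : ℝ), F (r, u) := by
    rw [← integral_const_mul_of_integrable hi1]
    refine setIntegral_congr_fun measurableSet_Ioi fun r hr => ?_
    have hr' : (0 : ℝ) < r := hr
    have e3 := integral_rpow_smul_comp_mul (fun s : ℝ => R s) θ hr'
    have e4 : ∫ u in Ioi (0 : ℝ), F (r, u) =
        R r * ∫ u in Ioi (0 : ℝ), u ^ (-(1 - θ)) • R ((u * r : ℝ) : ℂ) := by
      rw [← integral_const_mul_of_integrable (inner_int r hr')]
      simp only [F, mul_smul_comm]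
    rw [e4, e3, mul_smul_comm, mul_smul_comm, mul_comm]
  rw [e1, integral_integral_swap hF]
  set g : ℝ → ℝ := fun u => u ^ (-(1 - θ)) * (Real.log u / (u - 1))
  have hgae : (fun u : ℝ => ∫ r in Ioi (0 : ℝ), F (r, u)) =ᵐ[volume.restrict (Ioi (0 : ℝ))]
      fun u => g u • R 0 := by
    have hne : ∀ᵐ u : ℝ ∂(volume.restrict (Ioi (0 : ℝ))), u ≠ 1 :=
      ae_restrict_of_ae (Measure.ae_ne volume 1)
    filter_upwards [ae_restrict_mem measurableSet_Ioi, hne] with u hu hu1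
    simp only [F, g]
    rw [integral_smul, h.integral_mul_comp_mul hu hu1, smul_smul]
  rw [integral_congr_ae hgae]
  by_cases hR0 : R 0 = 0
  -- Integrability of g is read off from that of g • R 0, so R 0 = 0 is treated separately.
  · exact ⟨1, one_ne_zero, by simp [hR0]⟩
  refine ⟨∫ u in Ioi (0 : ℝ), g u, ?_, integral_smul_const _ _⟩
  have hgi : IntegrableOn g (Ioi 0) := by
    have := (hF.integral_prod_right).congr hgae
    exact (integrable_smul_const hR0).1 this
  have hgpos : ∀ u : ℝ, 0 < u → u ≠ 1 → 0 < g u := by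
    intro u hu hu1
    refine mul_pos (by positivity) ?_
    rcases lt_or_gt_of_ne hu1 with h' | h'
    · exact div_pos_of_neg_of_neg (Real.log_neg hu h') (by linarith)
    · exact div_pos (Real.log_pos h') (by linarith)
  -- The constant is the integral of u^(θ-1) log u / (u - 1), positive since log u and u - 1 have
  -- the same sign.
  refine ne_of_gt ?_
  rw [setIntegral_pos_iff_support_of_nonneg_ae ?_ hgi]
  · refine lt_of_lt_of_le ?_ (measure_mono (s := Ioo (0 : ℝ) 1) fun u hu =>
      ⟨(hgpos u hu.1 hu.2.ne).ne', hu.1⟩)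
    simp
  · filter_upwards [ae_restrict_mem measurableSet_Ioi] with u hu
    rcases eq_or_ne u 1 with rfl | hu1
    · simp [g]
    · exact (hgpos u hu hu1).le

end IsPolyResolvent

/-! ### Growth, orbits and density of the domain -/

section Semigroup

variable {X : Type*} [NormedAddCommGroup X] [NormedSpace ℂ X] {T : ℝ → X →L[ℂ] X}

theorem HasGeneratorValue.mem_domain {x y : X} (h : HasGeneratorValue T x y) :
    x ∈ (semigroupGenerator T).domain := ⟨y, h⟩

theorem hasGeneratorValue_apply (x : (semigroupGenerator T).domain) :
    HasGeneratorValue T (x : X) (semigroupGenerator T x) := Classical.choose_spec x.2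

theorem LinearPMap.isResolventAt_resolvent {A : X →ₗ.[ℂ] X} {z : ℂ} (hz : z ∈ A.resolventSet) :
    IsResolventAt A z (A.resolvent z) := by
  rw [LinearPMap.resolvent, dif_pos hz]
  exact Classical.choose_spec hz

theorem IsResolventAt.sub_eq {A : X →ₗ.[ℂ] X} {z w : ℂ} {R S : X →L[ℂ] X}
    (hR : IsResolventAt A z R) (hS : IsResolventAt A w S) : R - S = (w - z) • (R * S) := by
  ext x
  obtain ⟨hx, hx'⟩ := hS.1 x
  have h1 := hR.2 ⟨S x, hx⟩
  simp only at h1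
  have h2 : R x = S x + (w - z) • R (S x) := by
    conv_lhs => rw [← hx']
    have : w • S x - A ⟨S x, hx⟩ = (z • S x - A ⟨S x, hx⟩) + (w - z) • S x := by module
    rw [this, map_add, h1, map_smul]
  simp [h2]

namespace IsC0Semigroup

theorem continuous_max_apply (hT : IsC0Semigroup T) (x : X) :
    Continuous fun t : ℝ => T (max t 0) x :=
  (hT.continuousOn_orbit x).comp_continuous (by fun_prop) fun t => le_max_right t 0

theorem apply_add (hT : IsC0Semigroup T) {r t : ℝ} (hr : 0 ≤ r) (ht : 0 ≤ t) (x : X) :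
    T (r + t) x = T r (T t x) := by
  rw [hT.map_add r t hr ht]
  rfl

theorem exists_norm_le_exp [CompleteSpace X] (hT : IsC0Semigroup T) :
    ∃ M ω : ℝ, 1 ≤ M ∧ 0 ≤ ω ∧ ∀ t : ℝ, 0 ≤ t → ‖T t‖ ≤ M * Real.exp (ω * t) := by
  obtain ⟨C, hC⟩ : ∃ C, ∀ t : Icc (0 : ℝ) 1, ‖T t‖ ≤ C := by
    refine banach_steinhaus fun x => ?_
    obtain ⟨C, hC⟩ := isCompact_Icc.exists_bound_of_continuousOn
      ((hT.continuousOn_orbit x).mono (Icc_subset_Ici_self : Icc (0 : ℝ) 1 ⊆ Ici 0))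
    exact ⟨C, fun t => hC t t.2⟩
  set M := max C 1
  have hM : 1 ≤ M := le_max_right _ _
  have hM1 : ∀ t : ℝ, 0 ≤ t → t ≤ 1 → ‖T t‖ ≤ M := fun t h0 h1 =>
    (hC ⟨t, h0, h1⟩).trans (le_max_left _ _)
  have hn : ∀ (n : ℕ) (t : ℝ), n ≤ t → t ≤ n + 1 → ‖T t‖ ≤ M ^ (n + 1) := by
    intro n
    induction n with
    | zero =>
      intro t h0 h1
      simpa using hM1 t (by simpa using h0) (by simpa using h1)
    | succ n ih =>
      intro t h0 h1
      push_cast at h0 h1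
      have e : T t = T (t - 1) * T 1 := by
        rw [← hT.map_add (t - 1) 1 (by linarith [Nat.cast_nonneg (α := ℝ) n]) zero_le_one]
        simp
      rw [e, pow_succ]
      exact (norm_mul_le _ _).trans (mul_le_mul (ih _ (by linarith) (by linarith))
        (hM1 1 zero_le_one le_rfl) (norm_nonneg _) (by positivity))
  refine ⟨M, Real.log M, hM, Real.log_nonneg hM, fun t ht => ?_⟩
  have hM0 : 0 < M := by linarith
  have h1 := hn ⌊t⌋₊ t (Nat.floor_le ht) (Nat.lt_floor_add_one t).le
  have h2 : M ^ ⌊t⌋₊ ≤ Real.exp (Real.log M * t) := by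
    rw [← Real.rpow_natCast, ← Real.rpow_def_of_pos hM0]
    exact Real.rpow_le_rpow_of_exponent_le hM (Nat.floor_le ht)
  rw [pow_succ'] at h1
  exact h1.trans (by gcongr)

theorem hasGeneratorValue_apply (hT : IsC0Semigroup T) {x y : X} (h : HasGeneratorValue T x y)
    {t : ℝ} (ht : 0 ≤ t) : HasGeneratorValue T (T t x) (T t y) := by
  have h1 := ((T t).continuous.tendsto y).comp h
  refine h1.congr' ?_
  filter_upwards [self_mem_nhdsWithin] with r hr
  have hr' : (0 : ℝ) ≤ r := le_of_lt hr
  rw [Function.comp_apply, ← hT.apply_add hr' ht, add_comm, hT.apply_add ht hr', ← map_sub]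
  simp [← Complex.coe_smul]

/-- A right derivative is all the definition of the generator gives directly, and it is enough for
the fundamental theorem of calculus in `laplace_sub_eq`. -/
theorem hasDerivWithinAt_orbit (hT : IsC0Semigroup T) {x y : X} (h : HasGeneratorValue T x y)
    {t : ℝ} (ht : 0 ≤ t) : HasDerivWithinAt (fun s => T s x) (T t y) (Ioi t) t := by
  rw [hasDerivWithinAt_iff_tendsto_slope' self_notMem_Ioi]
  have h1 := hT.hasGeneratorValue_apply h ht
  have h2 : Tendsto (fun s : ℝ => s - t) (𝓝[>] t) (𝓝[>] 0) := by
    refine tendsto_nhdsWithin_iff.2 ⟨?_, ?_⟩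
    · have : Tendsto (fun s : ℝ => s - t) (𝓝 t) (𝓝 (t - t)) := tendsto_id.sub_const t
      rw [sub_self] at this
      exact this.mono_left nhdsWithin_le_nhds
    · filter_upwards [self_mem_nhdsWithin] with s hs
      exact sub_pos.2 (mem_Ioi.1 hs)
  refine (h1.comp h2).congr' ?_
  filter_upwards [self_mem_nhdsWithin] with s hs
  have hs' : 0 ≤ s - t := (sub_pos.2 (mem_Ioi.1 hs)).le
  rw [Function.comp_apply, ← hT.apply_add hs' ht, sub_add_cancel, slope_def_module]

theorem hasGeneratorValue_integral [CompleteSpace X] (hT : IsC0Semigroup T) (x : X) {h : ℝ}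
    (hh : 0 ≤ h) :
    HasGeneratorValue T (∫ s in (0 : ℝ)..h, T (max s 0) x) (T h x - x) := by
  set u : ℝ → X := fun s => T (max s 0) x
  have hu : Continuous u := hT.continuous_max_apply x
  set G : ℝ → X := fun t => ∫ s in (0 : ℝ)..t, u s
  have hG : ∀ t, HasDerivAt G (u t) t := fun t => (hu.integral_hasStrictDerivAt 0 t).hasDerivAt
  have hslope : ∀ t, Tendsto (fun r : ℝ => r⁻¹ • (G (t + r) - G t)) (𝓝[>] 0) (𝓝 (u t)) := by
    intro t
    have := (hG t).tendsto_slope_zero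
    exact this.mono_left (nhdsWithin_mono _ fun r hr => (ne_of_gt hr))
  have h1 := (hslope h).sub (hslope 0)
  have e1 : u h = T h x := by simp [u, max_eq_left hh]
  have e2 : u 0 = x := by simp [u, hT.map_zero]
  rw [e1, e2] at h1
  refine h1.congr' ?_
  filter_upwards [self_mem_nhdsWithin] with r hr
  have hr' : (0 : ℝ) ≤ r := le_of_lt hr
  have e3 : T r (∫ s in (0 : ℝ)..h, u s) = G (h + r) - G r := by
    rw [← (T r).intervalIntegral_comp_comm (hu.intervalIntegrable 0 h)]
    have e4 : ∫ s in (0 : ℝ)..h, T r (u s) = ∫ s in (0 : ℝ)..h, u (s + r) := by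
      refine intervalIntegral.integral_congr fun s hs => ?_
      rw [uIcc_of_le hh] at hs
      simp only [u]
      rw [max_eq_left hs.1, max_eq_left (add_nonneg hs.1 hr'), add_comm, hT.apply_add hr' hs.1]
    rw [e4, intervalIntegral.integral_comp_add_right, zero_add]
    exact (intervalIntegral.integral_interval_sub_left (hu.intervalIntegrable _ _)
      (hu.intervalIntegrable _ _)).symm
  rw [e3, ← smul_sub]
  congr 1
  have : G 0 = 0 := intervalIntegral.integral_same
  simp only [zero_add, this, sub_zero]
  change _ = G (h + r) - G r - G h
  abel

/-- The averages of an orbit over [0, r] lie in the domain and tend to its starting point as r ↓ 0.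
-/
theorem denseRange_resolvent [CompleteSpace X] (hT : IsC0Semigroup T) {z : ℂ} {R : X →L[ℂ] X}
    (hR : IsResolventAt (semigroupGenerator T) z R) : DenseRange R := by
  intro x
  have hu := hT.continuous_max_apply x
  have h1 : Tendsto (fun r : ℝ => r⁻¹ • ∫ s in (0 : ℝ)..r, T (max s 0) x) (𝓝[>] 0) (𝓝 x) := by
    have := (hu.integral_hasStrictDerivAt 0 0).hasDerivAt.tendsto_slope_zero
    simp only [zero_add, intervalIntegral.integral_same, sub_zero, max_self, hT.map_zero] at this
    exact this.mono_left (nhdsWithin_mono _ fun r hr => (ne_of_gt hr))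
  refine mem_closure_of_tendsto h1 ?_
  filter_upwards [self_mem_nhdsWithin] with r hr
  have h2 := hT.hasGeneratorValue_integral x (le_of_lt hr : 0 ≤ r)
  have h3 := hR.2 ⟨_, h2.mem_domain⟩
  rw [← Complex.coe_smul]
  exact ⟨((r⁻¹ : ℝ) : ℂ) • _, by rw [map_smul, h3]⟩

theorem denseRange_resolvent_pow [CompleteSpace X] (hT : IsC0Semigroup T) {z : ℂ}
    {R : X →L[ℂ] X} (hR : IsResolventAt (semigroupGenerator T) z R) (n : ℕ) :
    DenseRange ⇑(R ^ n) := by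
  induction n with
  | zero => exact fun x => subset_closure ⟨x, rfl⟩
  | succ n ih =>
    rw [pow_succ]
    exact ih.comp (hT.denseRange_resolvent hR) (R ^ n).continuous

end IsC0Semigroup

end Semigroup

/-! ### Laplace transforms of orbits to the right of the growth bound -/

theorem integrableOn_pow_mul_exp_neg {b : ℝ} (hb : 0 < b) (N : ℕ) :
    IntegrableOn (fun t : ℝ => t ^ N * Real.exp (-(b * t))) (Ioi 0) := by
  have := integrableOn_rpow_mul_exp_neg_mul_rpow (s := N) (p := 1) (b := b)
    (by linarith [Nat.cast_nonneg (α := ℝ) N]) one_pos hb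
  refine this.congr_fun (fun t ht => ?_) measurableSet_Ioi
  simp

theorem tendsto_pow_mul_exp_neg {b : ℝ} (hb : 0 < b) (N : ℕ) :
    Tendsto (fun t : ℝ => t ^ N * Real.exp (-(b * t))) atTop (𝓝 0) := by
  have h1 := (Real.tendsto_pow_mul_exp_neg_atTop_nhds_zero N).comp
    (tendsto_id.const_mul_atTop hb)
  have h2 := h1.const_mul ((b ^ N)⁻¹)
  rw [mul_zero] at h2
  refine h2.congr fun t => ?_
  simp only [Function.comp_apply, id, mul_pow]
  field_simp

section Laplace

variable {X : Type*} [NormedAddCommGroup X] [NormedSpace ℂ X] {T : ℝ → X →L[ℂ] X}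
  {M ω : ℝ}

namespace IsC0Semigroup

theorem continuousOn_laplace_integrand (hT : IsC0Semigroup T) (z : ℂ) (N : ℕ) (x : X) :
    ContinuousOn (fun t : ℝ => (Complex.exp (-z * t) * (t : ℂ) ^ N) • T t x) (Ici 0) :=
  ContinuousOn.smul (Continuous.continuousOn (by fun_prop)) (hT.continuousOn_orbit x)

theorem norm_laplace_integrand_le (hM : ∀ t : ℝ, 0 ≤ t → ‖T t‖ ≤ M * Real.exp (ω * t))
    (z : ℂ) (N : ℕ) (x : X) {t : ℝ} (ht : 0 ≤ t) :
    ‖(Complex.exp (-z * t) * (t : ℂ) ^ N) • T t x‖ ≤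
      M * ‖x‖ * (t ^ N * Real.exp (-((z.re - ω) * t))) := by
  rw [norm_smul, norm_mul, Complex.norm_exp, norm_pow, Complex.norm_real, Real.norm_of_nonneg ht]
  have e : (-z * t).re = -(z.re * t) := by simp
  have e2 : Real.exp (-((z.re - ω) * t)) = Real.exp (-(z.re * t)) * Real.exp (ω * t) := by
    rw [← Real.exp_add]
    congr 1
    ring
  rw [e, e2]
  calc _ ≤ Real.exp (-(z.re * t)) * t ^ N * (M * Real.exp (ω * t) * ‖x‖) := by
        gcongr
        exact ((T t).le_opNorm x).trans (by gcongr; exact hM t ht)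
    _ = _ := by ring

theorem integrableOn_laplace_integrand (hT : IsC0Semigroup T)
    (hM : ∀ t : ℝ, 0 ≤ t → ‖T t‖ ≤ M * Real.exp (ω * t)) {z : ℂ} (hz : ω < z.re) (N : ℕ) (x : X) :
    IntegrableOn (fun t : ℝ => (Complex.exp (-z * t) * (t : ℂ) ^ N) • T t x) (Ioi 0) := by
  refine ((integrableOn_pow_mul_exp_neg (sub_pos.2 hz) N).const_mul (M * ‖x‖)).mono'
    (((hT.continuousOn_laplace_integrand z N x).mono Ioi_subset_Ici_self).aestronglyMeasurable
      measurableSet_Ioi) ?_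
  filter_upwards [ae_restrict_mem measurableSet_Ioi] with t ht
  exact norm_laplace_integrand_le hM z N x (le_of_lt ht)

/-- Integration by parts for e^{-zt} t^N T(t) x. The boundary value at 0 is `0 ^ N • x`, nonzero
only for N = 0; in that case the truncated exponent `N - 1` is harmless because of the factor N. -/
theorem laplace_sub_eq [CompleteSpace X] (hT : IsC0Semigroup T)
    (hM : ∀ t : ℝ, 0 ≤ t → ‖T t‖ ≤ M * Real.exp (ω * t)) {z : ℂ} (hz : ω < z.re) (N : ℕ)
    {x y : X} (h : HasGeneratorValue T x y) :
    ∫ t in Ioi (0 : ℝ), (Complex.exp (-z * t) * (t : ℂ) ^ N) • T t (z • x - y) =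
      (N : ℂ) • (∫ t in Ioi (0 : ℝ), (Complex.exp (-z * t) * (t : ℂ) ^ (N - 1)) • T t x) +
        (0 : ℂ) ^ N • x := by
  set F : ℝ → X := fun t => (Complex.exp (-z * t) * (t : ℂ) ^ N) • T t x
  set F' : ℝ → X := fun t => (N : ℂ) • ((Complex.exp (-z * t) * (t : ℂ) ^ (N - 1)) • T t x) -
    (Complex.exp (-z * t) * (t : ℂ) ^ N) • T t (z • x - y)
  have hi1 := (hT.integrableOn_laplace_integrand hM hz (N - 1) x).smul (N : ℂ)
  have hi2 := hT.integrableOn_laplace_integrand hM hz N (z • x - y)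
  have hF' : IntegrableOn F' (Ioi 0) := hi1.sub hi2
  have hderiv : ∀ t : ℝ, 0 ≤ t → HasDerivWithinAt F (F' t) (Ioi t) t := by
    intro t ht
    have d1 : HasDerivAt (fun t : ℝ => Complex.exp (-z * t) * (t : ℂ) ^ N)
        (-z * Complex.exp (-z * t) * (t : ℂ) ^ N +
          Complex.exp (-z * t) * (N * (t : ℂ) ^ (N - 1))) t := by
      have d2 : HasDerivAt (fun w : ℂ => Complex.exp (-z * w) * w ^ N)
          (Complex.exp (-z * t) * (-z) * (t : ℂ) ^ N +
            Complex.exp (-z * t) * (N * (t : ℂ) ^ (N - 1))) (t : ℂ) := by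
        have d3 : HasDerivAt (fun w : ℂ => -z * w) (-z) (t : ℂ) := by
          simpa using (hasDerivAt_id (t : ℂ)).const_mul (-z)
        exact d3.cexp.mul (hasDerivAt_pow N (t : ℂ))
      convert d2.comp_ofReal using 1
      ring
    have d4 := d1.hasDerivWithinAt.smul (hT.hasDerivWithinAt_orbit h ht)
    refine d4.congr_deriv ?_
    simp only [F', map_sub, map_smul]
    module
  have hlim : Tendsto F atTop (𝓝 0) := by
    have := (tendsto_pow_mul_exp_neg (sub_pos.2 hz) N).const_mul (M * ‖x‖)
    rw [mul_zero] at this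
    refine squeeze_zero_norm' ?_ this
    filter_upwards [eventually_ge_atTop 0] with t ht
    exact norm_laplace_integrand_le hM z N x ht
  have hFTC : ∀ b : ℝ, 0 ≤ b → ∫ t in (0 : ℝ)..b, F' t = F b - F 0 := by
    intro b hb
    refine intervalIntegral.integral_eq_sub_of_hasDeriv_right_of_le hb
      ((hT.continuousOn_laplace_integrand z N x).mono Icc_subset_Ici_self)
      (fun t ht => hderiv t ht.1.le) ?_
    rw [intervalIntegrable_iff_integrableOn_Ioc_of_le hb]
    exact hF'.mono_set Ioc_subset_Ioi_self
  have t1 := intervalIntegral_tendsto_integral_Ioi 0 hF' tendsto_id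
  have t2 : Tendsto (fun b : ℝ => ∫ t in (0 : ℝ)..b, F' t) atTop (𝓝 (0 - F 0)) := by
    refine (hlim.sub_const (F 0)).congr' ?_
    filter_upwards [eventually_ge_atTop 0] with b hb using (hFTC b hb).symm
  have e := tendsto_nhds_unique t1 t2
  have e2 : ∫ t in Ioi (0 : ℝ), F' t =
      (N : ℂ) • (∫ t in Ioi (0 : ℝ), (Complex.exp (-z * t) * (t : ℂ) ^ (N - 1)) • T t x) -
      ∫ t in Ioi (0 : ℝ), (Complex.exp (-z * t) * (t : ℂ) ^ N) • T t (z • x - y) := by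
    rw [← integral_smul]
    exact integral_sub hi1 hi2
  have e3 : F 0 = (0 : ℂ) ^ N • x := by simp [F, hT.map_zero]
  rw [e2, e3, zero_sub, sub_eq_iff_eq_add] at e
  rw [e]
  abel

/-- Integration by parts applied to R x in place of x lowers N by one and produces one factor of R.
-/
theorem laplace_eq [CompleteSpace X] (hT : IsC0Semigroup T)
    (hM : ∀ t : ℝ, 0 ≤ t → ‖T t‖ ≤ M * Real.exp (ω * t)) {z : ℂ} (hz : ω < z.re)
    {R : X →L[ℂ] X} (hR : IsResolventAt (semigroupGenerator T) z R) (N : ℕ) (x : X) :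
    ∫ t in Ioi (0 : ℝ), (Complex.exp (-z * t) * (t : ℂ) ^ N) • T t x =
      (N.factorial : ℂ) • (R ^ (N + 1)) x := by
  induction N generalizing x with
  | zero =>
    obtain ⟨hx, hx'⟩ := hR.1 x
    have := hT.laplace_sub_eq hM hz 0 (_root_.hasGeneratorValue_apply ⟨R x, hx⟩)
    rw [hx'] at this
    simpa using this
  | succ N ih =>
    obtain ⟨hx, hx'⟩ := hR.1 x
    have := hT.laplace_sub_eq hM hz (N + 1) (_root_.hasGeneratorValue_apply ⟨R x, hx⟩)
    rw [hx'] at this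
    rw [this, Nat.add_sub_cancel, ih, smul_smul, Nat.factorial_succ, pow_succ R (N + 1)]
    simp

theorem norm_resolvent_le [CompleteSpace X] (hT : IsC0Semigroup T) (hM0 : 0 ≤ M)
    (hM : ∀ t : ℝ, 0 ≤ t → ‖T t‖ ≤ M * Real.exp (ω * t)) {z : ℂ} (hz : ω < z.re)
    {R : X →L[ℂ] X} (hR : IsResolventAt (semigroupGenerator T) z R) : ‖R‖ ≤ M / (z.re - ω) := by
  have hb : 0 < z.re - ω := sub_pos.2 hz
  refine R.opNorm_le_bound (by positivity) fun x => ?_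
  have h1 := hT.laplace_eq hM hz hR 0 x
  simp only [pow_zero, mul_one, Nat.factorial_zero, Nat.cast_one, one_smul, zero_add,
    pow_one] at h1
  rw [← h1]
  have hi := (integrableOn_pow_mul_exp_neg hb 0).const_mul (M * ‖x‖)
  simp only [pow_zero, one_mul] at hi
  refine (norm_integral_le_of_norm_le hi ?_).trans_eq ?_
  · filter_upwards [ae_restrict_mem measurableSet_Ioi] with t ht
    simpa using norm_laplace_integrand_le hM z 0 x (le_of_lt ht)
  · rw [integral_const_mul]
    have := integral_exp_mul_Ioi (a := -(z.re - ω)) (by linarith) 0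
    simp only [neg_mul, mul_zero, Real.exp_zero] at this
    rw [this]
    field_simp

end IsC0Semigroup

end Laplace

/-! ### Damped orbits and their Fourier transforms -/

section Decay

open FourierTransform

variable {X : Type*} [NormedAddCommGroup X] [InnerProductSpace ℂ X]
  {T : ℝ → X →L[ℂ] X} {M ω : ℝ} {R : ℂ → X →L[ℂ] X}

/-- `t ↦ e^{-at} t^N T(t) x` on `(0, ∞)`, extended by zero. -/
def dampedOrbit (T : ℝ → X →L[ℂ] X) (a : ℝ) (N : ℕ) (x : X) : ℝ → X :=
  (Ioi (0 : ℝ)).indicator fun t => (Complex.exp (-(a : ℂ) * t) * (t : ℂ) ^ N) • T t x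

namespace IsC0Semigroup

theorem integrable_dampedOrbit (hT : IsC0Semigroup T)
    (hM : ∀ t : ℝ, 0 ≤ t → ‖T t‖ ≤ M * Real.exp (ω * t)) {a : ℝ} (ha : ω < a) (N : ℕ) (x : X) :
    Integrable (dampedOrbit T a N x) :=
  (integrable_indicator_iff measurableSet_Ioi).2
    (hT.integrableOn_laplace_integrand hM (z := a) (by simpa) N x)

theorem fourier_dampedOrbit [CompleteSpace X] (hT : IsC0Semigroup T)
    (hM : ∀ t : ℝ, 0 ≤ t → ‖T t‖ ≤ M * Real.exp (ω * t)) {a : ℝ} (ha : ω < a) (ξ : ℝ)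
    {S : X →L[ℂ] X}
    (hS : IsResolventAt (semigroupGenerator T) (a + (2 * Real.pi * ξ : ℝ) * Complex.I) S)
    (N : ℕ) (x : X) :
    𝓕 (dampedOrbit T a N x) ξ = (N.factorial : ℂ) • (S ^ (N + 1)) x := by
  rw [← hT.laplace_eq hM (by simpa) hS, Real.fourier_eq', ← integral_indicator measurableSet_Ioi]
  congr 1
  ext t
  by_cases ht : t ∈ Ioi (0 : ℝ)
  · rw [dampedOrbit, indicator_of_mem ht, indicator_of_mem ht, smul_smul, ← mul_assoc,
      ← Complex.exp_add]
    congr 3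
    simp
    ring
  · rw [dampedOrbit, indicator_of_notMem ht, indicator_of_notMem ht, smul_zero]

theorem memLp_indicator_exp_neg :
    MemLp ((Ioi (0 : ℝ)).indicator fun t => Real.exp (-t)) 2 := by
  have hm : AEStronglyMeasurable ((Ioi (0 : ℝ)).indicator fun t => Real.exp (-t)) volume :=
    (Real.continuous_exp.comp continuous_neg).aestronglyMeasurable.indicator measurableSet_Ioi
  rw [memLp_two_iff_integrable_sq hm]
  have : (fun t => ((Ioi (0 : ℝ)).indicator (fun t => Real.exp (-t)) t) ^ 2) =
      (Ioi (0 : ℝ)).indicator fun t => Real.exp (-2 * t) := by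
    ext t
    by_cases ht : t ∈ Ioi (0 : ℝ)
    · rw [indicator_of_mem ht, indicator_of_mem ht, ← Real.exp_nat_mul]
      congr 1
      push_cast
      ring
    · simp [indicator_of_notMem ht]
  rw [this, integrable_indicator_iff measurableSet_Ioi]
  exact integrableOn_exp_mul_Ioi (by norm_num) 0

/-- The `L²` norm of `e^{-t}` on `(0, ∞)`. -/
def l2NormExpNeg : ℝ :=
  (eLpNorm ((Ioi (0 : ℝ)).indicator fun t => Real.exp (-t)) 2 volume).toReal

theorem eLpNorm_dampedOrbit_le (hM0 : 0 ≤ M)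
    (hM : ∀ t : ℝ, 0 ≤ t → ‖T t‖ ≤ M * Real.exp (ω * t)) {a : ℝ} (ha : ω + 1 ≤ a) (x : X) :
    eLpNorm (dampedOrbit T a 0 x) 2 ≤ ENNReal.ofReal (M * ‖x‖ * l2NormExpNeg) := by
  rw [ENNReal.ofReal_mul (by positivity), l2NormExpNeg,
    ENNReal.ofReal_toReal memLp_indicator_exp_neg.2.ne]
  refine eLpNorm_le_mul_eLpNorm_of_ae_le_mul (ae_of_all _ fun t => ?_) 2
  by_cases ht : t ∈ Ioi (0 : ℝ)
  · have ht' : (0 : ℝ) < t := ht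
    rw [dampedOrbit, indicator_of_mem ht, indicator_of_mem ht]
    refine (norm_laplace_integrand_le hM a 0 x ht'.le).trans ?_
    rw [pow_zero, one_mul, Real.norm_of_nonneg (by positivity), Complex.ofReal_re]
    gcongr
    nlinarith
  · simp [dampedOrbit, indicator_of_notMem ht]

theorem memLp_dampedOrbit (hT : IsC0Semigroup T) (hM0 : 0 ≤ M)
    (hM : ∀ t : ℝ, 0 ≤ t → ‖T t‖ ≤ M * Real.exp (ω * t)) {a : ℝ} (ha : ω + 1 ≤ a) (x : X) :
    MemLp (dampedOrbit T a 0 x) 2 :=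
  ⟨(hT.integrable_dampedOrbit hM (by linarith) 0 x).aestronglyMeasurable,
    (eLpNorm_dampedOrbit_le hM0 hM ha x).trans_lt ENNReal.ofReal_lt_top⟩

/-- Plancherel for the exponentially damped orbit; the bound is uniform in a ≥ ω + 1, which later
gives uniformity in σ. -/
theorem eLpNorm_resolvent_le [CompleteSpace X] (hT : IsC0Semigroup T) (hM0 : 0 ≤ M)
    (hM : ∀ t : ℝ, 0 ≤ t → ‖T t‖ ≤ M * Real.exp (ω * t)) {a : ℝ} (ha : ω + 1 ≤ a)
    (hR : ∀ ξ : ℝ, IsResolventAt (semigroupGenerator T)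
      (a + (2 * Real.pi * ξ : ℝ) * Complex.I) (R (a + (2 * Real.pi * ξ : ℝ) * Complex.I))) (x : X) :
    eLpNorm (fun ξ : ℝ => R (a + (2 * Real.pi * ξ : ℝ) * Complex.I) x) 2 ≤
      ENNReal.ofReal (M * ‖x‖ * l2NormExpNeg) := by
  have e : (fun ξ : ℝ => R (a + (2 * Real.pi * ξ : ℝ) * Complex.I) x) =
      𝓕 (dampedOrbit T a 0 x) := by
    ext ξ
    rw [hT.fourier_dampedOrbit hM (by linarith) ξ (hR ξ)]
    simp
  rw [e, eLpNorm_fourier_eq_of_integrable (hT.integrable_dampedOrbit hM (by linarith) 0 x)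
    (hT.memLp_dampedOrbit hM0 hM ha x)]
  exact eLpNorm_dampedOrbit_le hM0 hM ha x

/-- `t ↦ e^{-at} (1 - e^{-wt}) t^N T(t) x` on `(0, ∞)`, extended by zero. -/
def dampedOrbitDiff (T : ℝ → X →L[ℂ] X) (w a : ℝ) (N : ℕ) (x : X) : ℝ → X :=
  fun t => (Complex.exp (-(a : ℂ) * (max t 0 : ℝ)) * (1 - Complex.exp (-(w : ℂ) * (max t 0 : ℝ))) *
    ((max t 0 : ℝ) : ℂ) ^ N) • T (max t 0) x

theorem dampedOrbitDiff_of_nonpos (w a : ℝ) (N : ℕ) (x : X) {t : ℝ} (ht : t ≤ 0) :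
    dampedOrbitDiff T w a N x t = 0 := by
  simp [dampedOrbitDiff, max_eq_right ht]

theorem dampedOrbitDiff_eq (w a : ℝ) (N : ℕ) (x : X) :
    dampedOrbitDiff T w a N x = fun t => dampedOrbit T a N x t - dampedOrbit T (a + w) N x t := by
  ext t
  by_cases ht : t ∈ Ioi (0 : ℝ)
  · have ht' : (0 : ℝ) < t := ht
    rw [dampedOrbit, dampedOrbit, indicator_of_mem ht, indicator_of_mem ht, dampedOrbitDiff,
      max_eq_left ht'.le, ← sub_smul]
    congr 1
    have : Complex.exp (-((a + w : ℝ) : ℂ) * t) =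
        Complex.exp (-(a : ℂ) * t) * Complex.exp (-(w : ℂ) * t) := by
      rw [← Complex.exp_add]
      congr 1
      push_cast
      ring
    rw [this]
    ring
  · rw [dampedOrbitDiff_of_nonpos _ _ _ _ (not_lt.1 ht), dampedOrbit, dampedOrbit,
      indicator_of_notMem ht, indicator_of_notMem ht, sub_zero]

/-- The factor 1 - e^{-wt} vanishes at 0, so the extension by zero has no jump even for N = 0; this
is needed for pointwise Fourier inversion. -/
theorem continuous_dampedOrbitDiff (hT : IsC0Semigroup T) (w a : ℝ) (N : ℕ) (x : X) :
    Continuous (dampedOrbitDiff T w a N x) :=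
  Continuous.smul (by fun_prop) (hT.continuous_max_apply x)

/-- Undoing the damping removes the dependence on the line, so inversion formulas on different
vertical lines can be compared. -/
theorem exp_smul_dampedOrbitDiff (w a b : ℝ) (N : ℕ) (x : X) (t : ℝ) :
    Complex.exp ((a : ℂ) * t) • dampedOrbitDiff T w a N x t =
      Complex.exp ((b : ℂ) * t) • dampedOrbitDiff T w b N x t := by
  rcases le_total t 0 with ht | ht
  · rw [dampedOrbitDiff_of_nonpos _ _ _ _ ht, dampedOrbitDiff_of_nonpos _ _ _ _ ht, smul_zero,
      smul_zero]
  · have h : ∀ c : ℝ, Complex.exp ((c : ℂ) * t) • dampedOrbitDiff T w c N x t =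
        ((1 - Complex.exp (-(w : ℂ) * t)) * (t : ℂ) ^ N) • T t x := by
      intro c
      rw [dampedOrbitDiff, max_eq_left ht, smul_smul]
      congr 1
      rw [← mul_assoc, ← mul_assoc, ← Complex.exp_add]
      simp
    rw [h, h]

theorem fourier_dampedOrbitDiff [CompleteSpace X] (hT : IsC0Semigroup T)
    (hM : ∀ t : ℝ, 0 ≤ t → ‖T t‖ ≤ M * Real.exp (ω * t)) {w a : ℝ} (hw : 0 ≤ w) (ha : ω < a)
    (ξ : ℝ) {S S' : X →L[ℂ] X}
    (hS : IsResolventAt (semigroupGenerator T) (a + (2 * Real.pi * ξ : ℝ) * Complex.I) S)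
    (hS' : IsResolventAt (semigroupGenerator T)
      ((a + w : ℝ) + (2 * Real.pi * ξ : ℝ) * Complex.I) S') (N : ℕ) (x : X) :
    𝓕 (dampedOrbitDiff T w a N x) ξ = (N.factorial : ℂ) • (S ^ (N + 1) - S' ^ (N + 1)) x := by
  have i1 := hT.integrable_dampedOrbit hM ha N x
  have i2 := hT.integrable_dampedOrbit hM (a := a + w) (by linarith) N x
  rw [sub_apply, smul_sub, ← hT.fourier_dampedOrbit hM ha ξ hS,
    ← hT.fourier_dampedOrbit hM (by linarith) ξ hS', dampedOrbitDiff_eq, Real.fourier_eq,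
    Real.fourier_eq, Real.fourier_eq, ← integral_sub]
  · simp_rw [smul_sub]
  · exact (Real.fourierIntegral_convergent_iff ξ).2 i1
  · exact (Real.fourierIntegral_convergent_iff ξ).2 i2

end IsC0Semigroup

end Decay

/-! ### Holomorphy and inversion on lines near the imaginary axis -/

/-- No local bound is assumed: for |z - w| ‖R z‖ < 1/2 the identity itself forces ‖R w‖ ≤ 2 ‖R z‖,
and then continuity. -/
theorem continuousAt_of_resolvent_identity {𝔸 : Type*} [NormedRing 𝔸] [NormedAlgebra ℂ 𝔸]
    {R : ℂ → 𝔸} {z : ℂ} (h : ∀ᶠ w in 𝓝 z, R w - R z = (z - w) • (R w * R z)) :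
    ContinuousAt R z := by
  set m := ‖R z‖
  have hm : 0 ≤ m := norm_nonneg _
  have hlim : Tendsto (fun w : ℂ => ‖z - w‖ * (2 * m * m)) (𝓝 z) (𝓝 0) := by
    have : Tendsto (fun w : ℂ => ‖z - w‖ * (2 * m * m)) (𝓝 z) (𝓝 (‖z - z‖ * (2 * m * m))) :=
      Continuous.tendsto (by fun_prop) z
    simpa using this
  have hsmall : ∀ᶠ w : ℂ in 𝓝 z, ‖z - w‖ * m < 1 / 2 := by
    have : Tendsto (fun w : ℂ => ‖z - w‖ * m) (𝓝 z) (𝓝 (‖z - z‖ * m)) :=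
      Continuous.tendsto (by fun_prop) z
    refine this.eventually_lt_const ?_
    simp
  rw [ContinuousAt, tendsto_iff_norm_sub_tendsto_zero]
  refine squeeze_zero' (Eventually.of_forall fun w => norm_nonneg _) ?_ hlim
  filter_upwards [h, hsmall] with w hw hs
  have h1 : ‖R w - R z‖ ≤ ‖z - w‖ * (‖R w‖ * m) := by
    rw [hw, norm_smul]
    gcongr
    exact norm_mul_le _ _
  have h2 : ‖R w‖ ≤ ‖R w - R z‖ + m := norm_le_norm_sub_add _ _
  have h3 : ‖R w‖ ≤ 2 * m := by nlinarith [norm_nonneg (R w)]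
  calc _ ≤ ‖z - w‖ * (‖R w‖ * m) := h1
    _ ≤ _ := by gcongr

theorem differentiableAt_of_resolvent_identity {𝔸 : Type*} [NormedRing 𝔸] [NormedAlgebra ℂ 𝔸]
    {R : ℂ → 𝔸} {z : ℂ} (h : ∀ᶠ w in 𝓝 z, R w - R z = (z - w) • (R w * R z)) :
    DifferentiableAt ℂ R z := by
  have hc := continuousAt_of_resolvent_identity h
  refine HasDerivAt.differentiableAt (f' := -(R z * R z)) ?_
  rw [hasDerivAt_iff_tendsto_slope]
  have h1 : Tendsto (fun w => -(R w * R z)) (𝓝[≠] z) (𝓝 (-(R z * R z))) :=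
    ((hc.tendsto.mul_const (R z)).neg).mono_left nhdsWithin_le_nhds
  refine h1.congr' ?_
  filter_upwards [nhdsWithin_le_nhds h, self_mem_nhdsWithin] with w hw hne
  have hne' : w - z ≠ 0 := sub_ne_zero.2 hne
  rw [slope_def_module, hw, ← neg_sub w z, neg_smul, smul_neg, smul_smul, inv_mul_cancel₀ hne',
    one_smul]

section Decay

open FourierTransform

variable {X : Type*} [NormedAddCommGroup X] [InnerProductSpace ℂ X]
  {T : ℝ → X →L[ℂ] X} {M ω : ℝ} {R : ℂ → X →L[ℂ] X}

namespace IsC0Semigroup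

theorem differentiableAt_resolvent {A : X →ₗ.[ℂ] X} {R : ℂ → X →L[ℂ] X}
    (hR : ∀ z : ℂ, 0 ≤ z.re → IsResolventAt A z (R z)) {z : ℂ} (hz : 0 < z.re) :
    DifferentiableAt ℂ R z := by
  refine differentiableAt_of_resolvent_identity ?_
  filter_upwards [(isOpen_lt continuous_const Complex.continuous_re).mem_nhds hz] with w hw
  exact (hR w (le_of_lt hw)).sub_eq (hR z hz.le)

/-- The Laplace transform of `(1 - e^{-wt}) t^N T(t) x`. -/
def laplaceDiff (R : ℂ → X →L[ℂ] X) (w : ℝ) (N : ℕ) (x : X) (z : ℂ) : X :=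
  (N.factorial : ℂ) • (R z ^ (N + 1) - R (z + w) ^ (N + 1)) x

theorem differentiableAt_laplaceDiff {A : X →ₗ.[ℂ] X}
    (hR : ∀ z : ℂ, 0 ≤ z.re → IsResolventAt A z (R z)) {w : ℝ} (hw : 0 ≤ w) (N : ℕ) (x : X)
    {z : ℂ} (hz : 0 < z.re) : DifferentiableAt ℂ (laplaceDiff R w N x) z := by
  have d1 := differentiableAt_resolvent hR hz
  have d2 : DifferentiableAt ℂ (fun u : ℂ => R (u + w)) z :=
    DifferentiableAt.comp z (g := R) (f := fun u : ℂ => u + w)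
      (differentiableAt_resolvent hR (by simp; linarith)) (by fun_prop)
  exact (((d1.pow (N + 1)).sub (d2.pow (N + 1))).clm_apply (differentiableAt_const x)).const_smul
    (N.factorial : ℂ)

theorem norm_laplaceDiff_le {C : ℝ} {w : ℝ} {N : ℕ} {x : X}
    (hC : ∀ z : ℂ, 0 ≤ z.re → ‖laplaceDiff R w N x z‖ ≤ C / (1 + ‖z‖) ^ 2) {z : ℂ}
    (hz : 0 ≤ z.re) : ‖laplaceDiff R w N x z‖ ≤ C / (1 + z.im ^ 2) := by
  have hC0 : 0 ≤ C := by
    have := (norm_nonneg _).trans (hC 0 le_rfl)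
    simpa using this
  refine (hC z hz).trans ?_
  gcongr
  have := Complex.abs_im_le_norm z
  nlinarith [sq_abs z.im, norm_nonneg z, abs_nonneg z.im]

theorem continuous_laplaceDiff_line {A : X →ₗ.[ℂ] X}
    (hR : ∀ z : ℂ, 0 ≤ z.re → IsResolventAt A z (R z)) {w : ℝ} (hw : 0 ≤ w) (N : ℕ) (x : X)
    {σ : ℝ} (hσ : 0 < σ) : Continuous fun ξ : ℝ =>
      laplaceDiff R w N x (σ + (2 * Real.pi * ξ : ℝ) * Complex.I) := by
  refine continuous_iff_continuousAt.2 fun ξ => ?_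
  exact ContinuousAt.comp (g := laplaceDiff R w N x)
    (f := fun ξ : ℝ => (σ + (2 * Real.pi * ξ : ℝ) * Complex.I : ℂ))
    (differentiableAt_laplaceDiff hR hw N x (by simpa)).continuousAt (by fun_prop)

theorem integrable_laplaceDiff_line {A : X →ₗ.[ℂ] X}
    (hR : ∀ z : ℂ, 0 ≤ z.re → IsResolventAt A z (R z)) {w : ℝ} (hw : 0 ≤ w) {N : ℕ} {x : X}
    {C : ℝ} (hC : ∀ z : ℂ, 0 ≤ z.re → ‖laplaceDiff R w N x z‖ ≤ C / (1 + ‖z‖) ^ 2)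
    {σ : ℝ} (hσ : 0 < σ) : Integrable fun ξ : ℝ =>
      laplaceDiff R w N x (σ + (2 * Real.pi * ξ : ℝ) * Complex.I) := by
  have hi := (integrable_inv_one_add_sq_mul C).comp_mul_left' (R := 2 * Real.pi) (by positivity)
  refine hi.mono' (continuous_laplaceDiff_line hR hw N x hσ).aestronglyMeasurable
    (ae_of_all _ fun ξ => ?_)
  simpa using norm_laplaceDiff_le hC (z := σ + (2 * Real.pi * ξ : ℝ) * Complex.I) (by simpa using hσ.le)

theorem exp_smul_fourierInv_laplaceDiff {w σ : ℝ} {N : ℕ} {x : X} (t : ℝ) :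
    Complex.exp ((σ : ℂ) * t) • 𝓕⁻ (fun ξ : ℝ =>
      laplaceDiff R w N x (σ + (2 * Real.pi * ξ : ℝ) * Complex.I)) t =
    |(2 * Real.pi)⁻¹| • ∫ y : ℝ, Complex.exp ((σ + y * Complex.I) * t) •
      laplaceDiff R w N x (σ + y * Complex.I) := by
  have h := Measure.integral_comp_mul_left (fun y : ℝ => Complex.exp ((σ + y * Complex.I) * t) •
      laplaceDiff R w N x (σ + y * Complex.I)) (2 * Real.pi)
  rw [← h, Real.fourierInv_eq', ← integral_smul]
  congr 1
  ext ξ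
  rw [smul_smul, ← Complex.exp_add]
  congr 2
  simp
  ring

/-- For σ ≤ ω the left side is not known to be integrable. Inversion is therefore carried out on a
line right of ω, and the inversion integral is shifted to Re z = σ, the quadratic decay of the
transform killing the horizontal sides. -/
theorem dampedOrbitDiff_eq_fourierInv [CompleteSpace X] (hT : IsC0Semigroup T)
    (hM : ∀ t : ℝ, 0 ≤ t → ‖T t‖ ≤ M * Real.exp (ω * t)) (hω : 0 ≤ ω)
    (hR : ∀ z : ℂ, 0 ≤ z.re → IsResolventAt (semigroupGenerator T) z (R z))
    {w : ℝ} (hw : 0 ≤ w) {N : ℕ} {x : X}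
    {C : ℝ} (hC : ∀ z : ℂ, 0 ≤ z.re → ‖laplaceDiff R w N x z‖ ≤ C / (1 + ‖z‖) ^ 2)
    {σ : ℝ} (hσ : 0 < σ) :
    dampedOrbitDiff T w σ N x = 𝓕⁻ (fun ξ : ℝ =>
      laplaceDiff R w N x (σ + (2 * Real.pi * ξ : ℝ) * Complex.I)) := by
  have hC0 : 0 ≤ C := by
    have := (norm_nonneg _).trans (hC 0 le_rfl)
    simpa using this
  set b := max (ω + 1) σ
  have hωb : ω < b := lt_of_lt_of_le (by linarith) (le_max_left _ _)
  have hσb : σ ≤ b := le_max_right _ _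
  have hb : 0 < b := hσ.trans_le hσb
  have hfour : 𝓕 (dampedOrbitDiff T w b N x) = fun ξ : ℝ =>
      laplaceDiff R w N x (b + (2 * Real.pi * ξ : ℝ) * Complex.I) := by
    ext ξ
    rw [hT.fourier_dampedOrbitDiff hM hw hωb ξ (hR _ (by simpa using hb.le))
      (hR _ (by simpa using by linarith)), laplaceDiff]
    congr 5
    push_cast
    ring
  have hint : Integrable (dampedOrbitDiff T w b N x) := by
    rw [dampedOrbitDiff_eq]
    exact (hT.integrable_dampedOrbit hM hωb N x).sub
      (hT.integrable_dampedOrbit hM (by linarith) N x)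
  have hinv : dampedOrbitDiff T w b N x = 𝓕⁻ (fun ξ : ℝ =>
      laplaceDiff R w N x (b + (2 * Real.pi * ξ : ℝ) * Complex.I)) := by
    rw [← hfour]
    refine ((hT.continuous_dampedOrbitDiff w b N x).fourierInv_fourier_eq hint ?_).symm
    rw [hfour]
    exact integrable_laplaceDiff_line hR hw hC hb
  ext t
  have hexp : Complex.exp ((σ : ℂ) * t) ≠ 0 := Complex.exp_ne_zero _
  rw [← smul_right_inj hexp, exp_smul_dampedOrbitDiff w σ b N x t, hinv,
    exp_smul_fourierInv_laplaceDiff, exp_smul_fourierInv_laplaceDiff]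
  congr 1
  refine (integral_vertical_line_eq (f := fun z => Complex.exp (z * t) • laplaceDiff R w N x z)
    (C := Real.exp (b * |t|) * C) hσb (fun z hz _ => ?_) fun z hz hzb => ?_).symm
  · exact DifferentiableAt.smul (by fun_prop)
      (differentiableAt_laplaceDiff hR hw N x (hσ.trans_le hz))
  · have hz0 : 0 ≤ z.re := hσ.le.trans hz
    rw [norm_smul, Complex.norm_exp, mul_div_assoc]
    gcongr
    · have : (z * t).re = z.re * t := by simp
      rw [this]
      calc z.re * t ≤ z.re * |t| := by gcongr; exact le_abs_self t
        _ ≤ b * |t| := by gcongr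
    · exact norm_laplaceDiff_le hC hz0

/-- The transform on Re z = σ is a bounded operator family applied to the L² function R(z + w) y.
The bound `hC` serves only to justify inversion; C does not appear in the result. -/
theorem eLpNorm_dampedOrbitDiff_le [CompleteSpace X] (hT : IsC0Semigroup T) (hM0 : 0 ≤ M)
    (hM : ∀ t : ℝ, 0 ≤ t → ‖T t‖ ≤ M * Real.exp (ω * t)) (hω : 0 ≤ ω)
    (hR : ∀ z : ℂ, 0 ≤ z.re → IsResolventAt (semigroupGenerator T) z (R z))
    {N : ℕ} {D : X →L[ℂ] X} {y : X}
    {C : ℝ} (hC : ∀ z : ℂ, 0 ≤ z.re →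
      ‖laplaceDiff R (ω + 1) N (D y) z‖ ≤ C / (1 + ‖z‖) ^ 2)
    {K : ℝ} (hD : ∀ z : ℂ, 0 ≤ z.re → Commute D (R z))
    (hK : ∀ z : ℂ, 0 ≤ z.re → ‖R z ^ N * D‖ ≤ K ∧ ‖R z ^ (N + 1) * D‖ ≤ K)
    {σ : ℝ} (hσ : 0 < σ) :
    eLpNorm (dampedOrbitDiff T (ω + 1) σ N (D y)) 2 ≤
      ENNReal.ofReal (N.factorial * (ω + 3) * K * (M * ‖y‖ * l2NormExpNeg)) := by
  have hK0 : 0 ≤ K := (norm_nonneg _).trans (hK 0 le_rfl).1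
  set w := ω + 1 with hw
  set h : ℝ → X := fun ξ : ℝ => laplaceDiff R w N (D y) (σ + (2 * Real.pi * ξ : ℝ) * Complex.I)
  set g : ℝ → X := fun ξ : ℝ => R ((σ + w : ℝ) + (2 * Real.pi * ξ : ℝ) * Complex.I) y
  have hg : eLpNorm g 2 ≤ ENNReal.ofReal (M * ‖y‖ * l2NormExpNeg) :=
    hT.eLpNorm_resolvent_le hM0 hM (by linarith) (fun ξ => hR _ (by simpa using by linarith)) y
  have hle : ∀ ξ, ‖h ξ‖ ≤ (N.factorial * (ω + 3) * K) * ‖g ξ‖ := by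
    intro ξ
    set z : ℂ := σ + (2 * Real.pi * ξ : ℝ) * Complex.I
    have hz : 0 ≤ z.re := by simpa [z] using hσ.le
    have hzw : 0 ≤ (z + w).re := by simp [z]; linarith
    have e0 : ((σ + w : ℝ) : ℂ) + (2 * Real.pi * ξ : ℝ) * Complex.I = z + w := by
      simp only [z]
      push_cast
      ring
    have e1 : R z = R (z + w) + (w : ℂ) • (R z * R (z + w)) := by
      have := (hR z hz).sub_eq (hR (z + w) hzw)
      rw [add_sub_cancel_left, sub_eq_iff_eq_add'] at this
      exact this
    have c1 : D * R z = R z * D := (hD z hz).eq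
    have c2 : D * R (z + w) = R (z + w) * D := (hD (z + w) hzw).eq
    -- One factor R(z + w) is pulled out to the right of D; what remains involves only R^N D and
    -- R^(N+1) D, and its norm is at most K + (ω + 1)K + K = (ω + 3)K.
    have e2 : (R z ^ (N + 1) - R (z + w) ^ (N + 1)) * D =
        (R z ^ N * D + (w : ℂ) • (R z ^ (N + 1) * D) - R (z + w) ^ N * D) * R (z + w) := by
      have e3 : R z ^ (N + 1) * D = R z ^ N * D * R z := by rw [pow_succ, mul_assoc, ← c1, mul_assoc]
      have e4 : R (z + w) ^ (N + 1) * D = R (z + w) ^ N * D * R (z + w) := by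
        rw [pow_succ, mul_assoc, ← c2, mul_assoc]
      have e5 : R z ^ N * D * R z =
          R z ^ N * D * R (z + w) + (w : ℂ) • (R z ^ (N + 1) * D * R (z + w)) := by
        refine (congrArg (R z ^ N * D * ·) e1).trans ?_
        rw [mul_add, mul_smul_comm, e3, mul_assoc _ (R z)]
      rw [sub_mul, sub_mul, add_mul, smul_mul_assoc, e4]
      congr 1
      exact e3.trans e5
    have e6 : h ξ = (N.factorial : ℂ) • (R z ^ N * D + (w : ℂ) • (R z ^ (N + 1) * D) -
        R (z + w) ^ N * D) (g ξ) := by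
      simp only [h, g, laplaceDiff, e0]
      congr 1
      exact congrArg (fun S : X →L[ℂ] X => S y) e2
    rw [e6, norm_smul, Complex.norm_natCast, mul_assoc, mul_assoc]
    gcongr
    rw [← mul_assoc]
    refine (ContinuousLinearMap.le_opNorm _ _).trans ?_
    gcongr
    calc _ ≤ K + w * K + K := by
          refine (norm_sub_le _ _).trans (add_le_add ((norm_add_le _ _).trans
            (add_le_add (hK z hz).1 ?_)) (hK _ hzw).1)
          rw [norm_smul, Complex.norm_real, Real.norm_of_nonneg (by linarith)]
          gcongr
          exact (hK z hz).2
      _ = (ω + 3) * K := by rw [hw]; ring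
  have hh : eLpNorm h 2 ≤ ENNReal.ofReal (N.factorial * (ω + 3) * K * (M * ‖y‖ * l2NormExpNeg)) := by
    refine (eLpNorm_le_mul_eLpNorm_of_ae_le_mul (ae_of_all _ hle) 2).trans ?_
    rw [ENNReal.ofReal_mul (by positivity : 0 ≤ N.factorial * (ω + 3) * K)]
    gcongr
  have hcont : Continuous h := continuous_laplaceDiff_line hR (by linarith) N (D y) hσ
  have hint : Integrable h := integrable_laplaceDiff_line hR (by linarith) hC hσ
  have hmem : MemLp h 2 := ⟨hcont.aestronglyMeasurable, hh.trans_lt ENNReal.ofReal_lt_top⟩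
  have hmp := Measure.measurePreserving_neg (volume : Measure ℝ)
  rw [hT.dampedOrbitDiff_eq_fourierInv hM hω hR (by linarith) hC hσ,
    Real.fourierInv_eq_fourier_comp_neg, eLpNorm_fourier_eq_of_integrable hint.comp_neg
    (hmem.comp_measurePreserving hmp)]
  refine (eLpNorm_comp_measurePreserving hmem.1 hmp).le.trans hh

end IsC0Semigroup

end Decay

/-! ### From L² bounds to pointwise decay -/

section Decay

variable {X : Type*} [NormedAddCommGroup X] [InnerProductSpace ℂ X]
  {T : ℝ → X →L[ℂ] X} {M ω : ℝ}

namespace IsC0Semigroup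

theorem norm_dampedOrbitDiff (w a : ℝ) (hw : 0 ≤ w) (N : ℕ) (x : X) {t : ℝ} (ht : 0 ≤ t) :
    ‖dampedOrbitDiff T w a N x t‖ =
      Real.exp (-(a * t)) * (1 - Real.exp (-(w * t))) * t ^ N * ‖T t x‖ := by
  have h1 : (1 - Complex.exp (-(w : ℂ) * (t : ℝ))) = ((1 - Real.exp (-(w * t)) : ℝ) : ℂ) := by
    push_cast
    rw [neg_mul]
  have h2 : 0 ≤ 1 - Real.exp (-(w * t)) := by
    rw [sub_nonneg, Real.exp_le_one_iff]
    have := mul_nonneg hw ht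
    linarith
  rw [dampedOrbitDiff, max_eq_left ht, norm_smul, norm_mul, norm_mul, h1, Complex.norm_real,
    Real.norm_of_nonneg h2, Complex.norm_exp, norm_pow, Complex.norm_real, Real.norm_of_nonneg ht]
  simp

/-- T(t) x = T(t - τ) T(τ) x shows that a large value at time t persists backwards over [t - 1/2,
t], where with σ = 1/t the damping e^{-τ/t} is at least e^{-1}. -/
theorem exists_pow_mul_norm_le_of_eLpNorm_le (hT : IsC0Semigroup T) (hM1 : 1 ≤ M)
    (hM : ∀ t : ℝ, 0 ≤ t → ‖T t‖ ≤ M * Real.exp (ω * t)) (hω : 0 ≤ ω) (N : ℕ) :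
    ∃ c, 0 ≤ c ∧ ∀ (x : X) (t B : ℝ), 1 ≤ t → 0 ≤ B →
      eLpNorm (dampedOrbitDiff T (ω + 1) (1 / t) N x) 2 ≤ ENNReal.ofReal B →
      t ^ N * ‖T t x‖ ≤ c * B := by
  -- On [t - 1/2, t] with t ≥ 1: e^{-τ/t} ≥ e^{-1}, τ ≥ 1/2 in the second factor, τ ≥ t/2 in the
  -- power, and ‖T(t - τ)‖ ≤ M e^ω.
  set k := Real.exp (-1) * (1 - Real.exp (-(1 / 2))) * (1 / 2) ^ N / (M * Real.exp ω)
  have hk : 0 < k := by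
    have h1 : Real.exp (-(1 / 2)) < 1 := Real.exp_lt_one_iff.2 (by norm_num)
    have h2 : 0 < 1 - Real.exp (-(1 / 2)) := sub_pos.2 h1
    positivity
  set v := (ENNReal.ofReal (1 / 2) ^ (1 / (2 : ENNReal).toReal)).toReal
  have hv : 0 < v := by
    refine ENNReal.toReal_pos ?_ ?_
    · simp
    · simp
  refine ⟨(k * v)⁻¹, by positivity, fun x t B ht hB h => ?_⟩
  have ht0 : 0 < t := by linarith
  set f := dampedOrbitDiff T (ω + 1) (1 / t) N x
  set a := k * (t ^ N * ‖T t x‖)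
  have ha : 0 ≤ a := by positivity
  have key : ∀ τ ∈ Icc (t - 1 / 2) t, a ≤ ‖f τ‖ := by
    intro τ hτ
    have hτ2 : t / 2 ≤ τ := by linarith [hτ.1]
    have hτ0 : 0 < τ := by linarith
    have e1 : T t x = T (t - τ) (T τ x) := by
      rw [← hT.apply_add (by linarith [hτ.2]) hτ0.le, sub_add_cancel]
    have e2 : ‖T t x‖ ≤ M * Real.exp ω * ‖T τ x‖ := by
      rw [e1]
      refine (ContinuousLinearMap.le_opNorm _ _).trans ?_
      gcongr
      refine (hM _ (by linarith [hτ.2])).trans ?_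
      gcongr
      nlinarith [hτ.1]
    rw [norm_dampedOrbitDiff _ _ (by linarith) _ _ hτ0.le]
    have e3 : Real.exp (-1) ≤ Real.exp (-(1 / t * τ)) := by
      gcongr
      rw [one_div_mul_eq_div, div_le_one ht0]
      exact hτ.2
    have e4 : 1 - Real.exp (-(1 / 2)) ≤ 1 - Real.exp (-((ω + 1) * τ)) := by
      gcongr
      nlinarith
    have e5 : 0 ≤ 1 - Real.exp (-(1 / 2)) :=
      sub_nonneg.2 (Real.exp_le_one_iff.2 (by norm_num))
    have e8 := e5.trans e4
    have e6 : 0 < M * Real.exp ω := by positivity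
    have e7 : a = Real.exp (-1) * (1 - Real.exp (-(1 / 2))) * (t / 2) ^ N *
        (‖T t x‖ / (M * Real.exp ω)) := by
      simp only [a, k, div_pow, one_pow]
      ring
    rw [e7]
    gcongr
    rw [div_le_iff₀ e6, mul_comm]
    exact e2
  have hle : eLpNorm ((Icc (t - 1 / 2) t).indicator fun _ : ℝ => a) 2 ≤ eLpNorm f 2 := by
    refine eLpNorm_mono fun τ => ?_
    by_cases hτ : τ ∈ Icc (t - 1 / 2) t
    · rw [indicator_of_mem hτ, Real.norm_of_nonneg ha]
      exact key τ hτ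
    · rw [indicator_of_notMem hτ, norm_zero]
      exact norm_nonneg _
  rw [eLpNorm_indicator_const measurableSet_Icc (by norm_num) (by norm_num), Real.volume_Icc,
    sub_sub_cancel] at hle
  have h2 := ENNReal.toReal_mono ENNReal.ofReal_ne_top (hle.trans h)
  rw [ENNReal.toReal_mul, ENNReal.toReal_ofReal hB, toReal_enorm, Real.norm_of_nonneg ha] at h2
  rw [inv_mul_eq_div, le_div_iff₀ (by positivity)]
  calc _ = a * v := by
        simp only [a]
        ring
    _ ≤ B := h2

/-- For y in the range of V the transform decays quadratically and the L² argument applies; since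
the resulting constant does not depend on C, density extends the bound to all y. -/
theorem exists_pow_mul_norm_apply_le [CompleteSpace X] {R : ℂ → X →L[ℂ] X}
    (hT : IsC0Semigroup T) (hM1 : 1 ≤ M)
    (hM : ∀ t : ℝ, 0 ≤ t → ‖T t‖ ≤ M * Real.exp (ω * t)) (hω : 0 ≤ ω)
    (hR : ∀ z : ℂ, 0 ≤ z.re → IsResolventAt (semigroupGenerator T) z (R z)) (N : ℕ)
    {V : X →L[ℂ] X} (hV : DenseRange V) {C : ℝ}
    (hVC : ∀ z : ℂ, 0 ≤ z.re →
      ‖(R z ^ (N + 1) - R (z + (ω + 1 : ℝ)) ^ (N + 1)) * V‖ ≤ C / (1 + ‖z‖) ^ 2) :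
    ∃ c, 0 ≤ c ∧ ∀ (D : X →L[ℂ] X) (K : ℝ), (∀ z : ℂ, 0 ≤ z.re → Commute D (R z)) →
      (∀ z : ℂ, 0 ≤ z.re → ‖R z ^ N * D‖ ≤ K ∧ ‖R z ^ (N + 1) * D‖ ≤ K) →
      ∀ (y : X) (t : ℝ), 1 ≤ t → t ^ N * ‖T t (D y)‖ ≤ c * K * ‖y‖ := by
  obtain ⟨c, hc, hcx⟩ := hT.exists_pow_mul_norm_le_of_eLpNorm_le hM1 hM hω N
  have hM0 : 0 ≤ M := by linarith
  have hl : 0 ≤ l2NormExpNeg := ENNReal.toReal_nonneg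
  refine ⟨c * (N.factorial * (ω + 3) * (M * l2NormExpNeg)), by positivity,
    fun D K hD hK y t ht => ?_⟩
  have hK0 : 0 ≤ K := (norm_nonneg _).trans (hK 0 le_rfl).1
  refine hV.induction_on (p := fun y => t ^ N * ‖T t (D y)‖ ≤
    c * (N.factorial * (ω + 3) * (M * l2NormExpNeg)) * K * ‖y‖) y
    (isClosed_le (by fun_prop) (by fun_prop)) fun y' => ?_
  have hbound : ∀ z : ℂ, 0 ≤ z.re → ‖laplaceDiff R (ω + 1) N (D (V y')) z‖ ≤
      N.factorial * ‖D‖ * C * ‖y'‖ / (1 + ‖z‖) ^ 2 := by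
    intro z hz
    have hz' : 0 ≤ (z + (ω + 1 : ℝ)).re := by
      simp
      linarith
    have hcomm : Commute D (R z ^ (N + 1) - R (z + (ω + 1 : ℝ)) ^ (N + 1)) :=
      ((hD z hz).pow_right _).sub_right ((hD _ hz').pow_right _)
    have e : laplaceDiff R (ω + 1) N (D (V y')) z = (N.factorial : ℂ) •
        D (((R z ^ (N + 1) - R (z + (ω + 1 : ℝ)) ^ (N + 1)) * V) y') := by
      rw [laplaceDiff]
      congr 1
      exact (congrArg (fun S : X →L[ℂ] X => S (V y')) hcomm.eq).symm
    rw [e, norm_smul, Complex.norm_natCast]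
    calc _ ≤ (N.factorial : ℝ) * (‖D‖ * (C / (1 + ‖z‖) ^ 2 * ‖y'‖)) := by
          gcongr
          refine (ContinuousLinearMap.le_opNorm _ _).trans ?_
          gcongr
          refine (ContinuousLinearMap.le_opNorm _ _).trans ?_
          gcongr
          exact hVC z hz
      _ = _ := by ring
  refine (hcx _ t _ ht (by positivity) (hT.eLpNorm_dampedOrbitDiff_le hM0 hM hω hR hbound hD hK
    (one_div_pos.2 (by linarith : 0 < t)))).trans_eq ?_
  ring

end IsC0Semigroup

end Decay

/-! ### Decay of the resolvent on ranges of powers of R(0) -/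

namespace IsPolyResolvent

variable {𝔸 : Type*} [NormedCommRing 𝔸] [NormedAlgebra ℂ 𝔸] {R : ℂ → 𝔸} {β C K : ℝ}

/-- For p ≥ β the product R(z) R(0)^p is bounded; one more R(0) gains z⁻¹ through the resolvent
identity. -/
theorem exists_norm_mul_zero_pow_le (h : IsPolyResolvent R β C K) :
    ∃ (p : ℕ) (c : ℝ), 0 ≤ c ∧ ∀ z : ℂ, 0 ≤ z.re → ‖R z * R 0 ^ p‖ ≤ c / (1 + ‖z‖) := by
  obtain ⟨p, hp⟩ := exists_nat_ge β
  obtain ⟨c, hc, hcz⟩ := h.exists_norm_pow_mul_negPow_le h.isNegPowLike_one p 1 le_rfl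
    (by push_cast; linarith)
  have hcz' : ∀ z : ℂ, 0 ≤ z.re → ‖R z * R 0 ^ p‖ ≤ c := by
    intro z hz
    simpa using hcz z (1 + ‖z‖) hz (by linarith [norm_nonneg z]) (by linarith)
  refine ⟨p + 1, 2 * (c * ‖R 0‖ + ‖R 0 ^ (p + 1)‖ + c), by positivity, fun z hz => ?_⟩
  rw [le_div_iff₀ (by positivity)]
  have h0 : ‖R z * R 0 ^ (p + 1)‖ ≤ c * ‖R 0‖ := by
    rw [pow_succ, ← mul_assoc]
    exact (norm_mul_le _ _).trans (by gcongr; exact hcz' z hz)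
  have hn := norm_nonneg (R z * R 0 ^ (p + 1))
  have hn2 := norm_nonneg (R 0 ^ (p + 1))
  rcases le_total ‖z‖ 1 with h1 | h1
  · nlinarith [norm_nonneg z]
  · have hz0 : z ≠ 0 := norm_pos_iff.1 (by linarith)
    have e : R z * R 0 ^ (p + 1) = z⁻¹ • (R 0 ^ (p + 1) - R z * R 0 ^ p) := by
      have := h.mul_zero_eq hz hz0
      rw [pow_succ', ← mul_assoc, this, smul_mul_assoc, sub_mul]
    have h2 : ‖z‖ * ‖R z * R 0 ^ (p + 1)‖ ≤ ‖R 0 ^ (p + 1)‖ + c := by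
      rw [e, norm_smul, norm_inv, mul_inv_cancel_left₀ (by positivity)]
      exact (norm_sub_le _ _).trans (by gcongr; exact hcz' z hz)
    have := mul_nonneg hc (norm_nonneg (R 0))
    nlinarith

/-- The difference telescopes through R(z) - R(z + w) = w R(z) R(z + w), which contains two decaying
factors once each is paired with R(0)^q. -/
theorem exists_norm_pow_sub_pow_mul_le (h : IsPolyResolvent R β C K) {w : ℝ} (hw : 0 ≤ w) (n : ℕ) :
    ∃ (p : ℕ) (c : ℝ), 0 ≤ c ∧ ∀ z : ℂ, 0 ≤ z.re →
      ‖(R z ^ n - R (z + w) ^ n) * R 0 ^ p‖ ≤ c / (1 + ‖z‖) ^ 2 := by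
  obtain ⟨q, d, hd, hdz⟩ := h.exists_norm_mul_zero_pow_le
  set S := R 0 ^ q
  suffices hs : ∃ c : ℝ, 0 ≤ c ∧ ∀ z : ℂ, 0 ≤ z.re →
      ‖(R z ^ n - R (z + w) ^ n) * S ^ (n + 1)‖ ≤ c / (1 + ‖z‖) ^ 2 by
    obtain ⟨c, hc, hcz⟩ := hs
    exact ⟨q * (n + 1), c, hc, fun z hz => by rw [pow_mul]; exact hcz z hz⟩
  have hzw : ∀ z : ℂ, 0 ≤ z.re → 0 ≤ (z + w).re ∧ ‖z‖ ≤ ‖z + w‖ := by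
    intro z hz
    refine ⟨by simp; linarith, ?_⟩
    rw [Complex.norm_def, Complex.norm_def]
    apply Real.sqrt_le_sqrt
    simp only [Complex.normSq_apply, Complex.add_re, Complex.add_im, Complex.ofReal_re,
      Complex.ofReal_im, add_zero]
    nlinarith
  have hb : ∀ z : ℂ, 0 ≤ z.re → ‖R (z + w) * S‖ ≤ d / (1 + ‖z‖) := fun z hz =>
    (hdz _ (hzw z hz).1).trans (by gcongr; exact (hzw z hz).2)
  have hdiv : ∀ z : ℂ, d / (1 + ‖z‖) ≤ d := fun z =>
    div_le_self hd (by linarith [norm_nonneg z])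
  induction n with
  | zero => exact ⟨0, le_rfl, by simp⟩
  | succ n ih =>
    obtain ⟨c, hc, hcz⟩ := ih
    obtain ⟨m, hm, hmz⟩ : ∃ m, 0 ≤ m ∧ ∀ z : ℂ, 0 ≤ z.re → ‖(R (z + w) * S) ^ n‖ ≤ m := by
      rcases n.eq_zero_or_pos with rfl | hn
      · exact ⟨‖(1 : 𝔸)‖, norm_nonneg _, by simp⟩
      · refine ⟨d ^ n, by positivity, fun z hz => (norm_pow_le' _ hn).trans ?_⟩
        gcongr
        exact (hb z hz).trans (hdiv z)
    refine ⟨d * c + w * (d * d * m), by positivity, fun z hz => ?_⟩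
    have e1 : R z - R (z + w) = (w : ℂ) • (R z * R (z + w)) := by
      have := h.sub_eq z (z + w) hz (hzw z hz).1
      rwa [add_sub_cancel_left] at this
    have e2 : (R z ^ (n + 1) - R (z + w) ^ (n + 1)) * S ^ (n + 1 + 1) =
        (R z * S) * ((R z ^ n - R (z + w) ^ n) * S ^ (n + 1)) +
        (w : ℂ) • ((R z * S) * (R (z + w) * S) * (R (z + w) * S) ^ n) := by
      have e3 : (w : ℂ) • ((R z * S) * (R (z + w) * S) * (R (z + w) * S) ^ n) =
          (R z - R (z + w)) * (S * S * (R (z + w) * S) ^ n) := by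
        rw [e1, smul_mul_assoc]
        congr 1
        ring
      rw [e3]
      ring
    rw [e2]
    calc _ ≤ d * (c / (1 + ‖z‖) ^ 2) + w * ((d / (1 + ‖z‖)) * (d / (1 + ‖z‖)) * m) := by
          refine (norm_add_le _ _).trans (add_le_add ?_ ?_)
          · exact (norm_mul_le _ _).trans (mul_le_mul ((hdz z hz).trans (hdiv z)) (hcz z hz)
              (norm_nonneg _) hd)
          · rw [norm_smul, Complex.norm_real, Real.norm_of_nonneg hw]
            gcongr
            refine (norm_mul_le _ _).trans (mul_le_mul ?_ (hmz z hz) (norm_nonneg _)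
              (by positivity))
            exact (norm_mul_le _ _).trans (mul_le_mul (hdz z hz) (hb z hz) (norm_nonneg _)
              (by positivity))
      _ = _ := by
          field_simp

end IsPolyResolvent

/-! ### Reduction to a commutative algebra and fractional powers -/

/-- A commuting family in a Banach algebra lives in a commutative Banach algebra. -/
theorem exists_normedCommRing_of_commute.{u} {𝔹 : Type u} [NormedRing 𝔹] [NormedAlgebra ℂ 𝔹]
    [CompleteSpace 𝔹] (s : Set 𝔹) (hs : ∀ a ∈ s, ∀ b ∈ s, a * b = b * a) :
    ∃ (𝔸 : Type u) (_ : NormedCommRing 𝔸) (_ : NormedAlgebra ℂ 𝔸) (_ : CompleteSpace 𝔸)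
      (ι : 𝔸 →ₐ[ℂ] 𝔹), (∀ a, ‖ι a‖ = ‖a‖) ∧ ∀ b ∈ s, ∃ a, ι a = b := by
  -- The double centralizer of a commuting set is commutative, closed, and contains the set.
  let 𝒮 : Subalgebra ℂ 𝔹 := Subalgebra.centralizer ℂ (Set.centralizer s)
  have hsub : s ⊆ Set.centralizer s := fun a ha b hb => hs b hb a ha
  have hcomm : ∀ a b : 𝒮, a * b = b * a := fun a b =>
    Subtype.ext (b.2 a (Set.centralizer_subset hsub a.2))
  have hcl : IsClosed (𝒮 : Set 𝔹) := Set.isClosed_centralizer _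
  let inst : NormedCommRing 𝒮 := { (inferInstance : NormedRing 𝒮) with mul_comm := hcomm }
  exact ⟨𝒮, inst, (inferInstance : NormedAlgebra ℂ 𝒮), hcl.completeSpace_coe, 𝒮.val,
    fun a => rfl, fun b hb => ⟨⟨b, fun a ha => (ha b hb).symm⟩, rfl⟩⟩

section FracPow

variable {X : Type*} [NormedAddCommGroup X] [NormedSpace ℂ X]

/-- If `B^{-α}` is injective, every `x ∈ D(B^α)` is `B^{-α} y` with `y = B^α x`. -/
theorem LinearPMap.negPow_fracPow_apply {B : X →ₗ.[ℂ] X} {α : ℝ}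
    (hinj : Function.Injective (B.negPow α)) (x : (B.fracPow α).domain) :
    B.negPow α (B.fracPow α x) = x := by
  set f : X →ₗ.[ℂ] X := (B.negPow α : X →ₗ[ℂ] X).toPMap ⊤
  have hker : LinearMap.ker f.toFun = ⊥ := by
    rw [LinearMap.ker_eq_bot']
    intro y hy
    have h0 : B.negPow α (y : X) = B.negPow α 0 := by
      rw [_root_.map_zero]
      exact hy
    exact Subtype.ext (hinj h0)
  have hx : (x : X) ∈ LinearMap.range f.toFun := by
    have := x.2
    change (x : X) ∈ f.inverse.domain at this
    rwa [LinearPMap.inverse_domain] at this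
  obtain ⟨y, hy⟩ := hx
  have h1 : B.fracPow α x = y := LinearPMap.inverse_apply_eq hker (y := x) (x := y) hy
  rw [h1]
  exact hy

theorem IsResolventAt.injective_zero {A : X →ₗ.[ℂ] X} {S : X →L[ℂ] X} (h : IsResolventAt A 0 S) :
    Function.Injective S := by
  rw [injective_iff_map_eq_zero]
  intro x hx
  obtain ⟨hd, he⟩ := h.1 x
  have h0 : A ⟨S x, hd⟩ = 0 := by
    have : (⟨S x, hd⟩ : A.domain) = 0 := Subtype.ext hx
    rw [this, A.map_zero]
  rw [← he, h0, hx]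
  simp

theorem IsResolventAt.commute {A : X →ₗ.[ℂ] X} {z w : ℂ} {S S' : X →L[ℂ] X}
    (h : IsResolventAt A z S) (h' : IsResolventAt A w S') (hzw : w ≠ z) : Commute S S' := by
  have h1 := h.sub_eq h'
  have h2 := h'.sub_eq h
  have h3 : (w - z) • (S * S' - S' * S) = 0 := by
    rw [smul_sub, ← h1, sub_eq_zero, ← neg_sub S' S, h2]
    module
  rw [smul_eq_zero, or_iff_right (sub_ne_zero.2 hzw), sub_eq_zero] at h3
  exact h3

/-- A polynomially bounded resolvent comes from a commutative Banach algebra, in which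
`(-A)^{-α}` splits as `r(0)^n B` with `n = ⌊α⌋` and `B` behaving like a negative power of order
`α - ⌊α⌋`. -/
theorem exists_negPow_model.{u} {X : Type u} [NormedAddCommGroup X] [NormedSpace ℂ X]
    [CompleteSpace X] {A : X →ₗ.[ℂ] X} {β C K : ℝ} (hβ : 0 ≤ β) (hC : 0 ≤ C)
    (hρ : ∀ z : ℂ, 0 ≤ z.re → z ∈ A.resolventSet)
    (hR : ∀ z : ℂ, 0 ≤ z.re → ‖A.resolvent z‖ ≤ C * (1 + ‖z‖) ^ β)
    (hK : ∀ r : ℝ, 0 ≤ r → ‖A.resolvent r‖ ≤ K / (1 + r)) (α : ℝ) :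
    ∃ (𝔸 : Type u) (_ : NormedCommRing 𝔸) (_ : NormedAlgebra ℂ 𝔸)
      (ι : 𝔸 →ₐ[ℂ] (X →L[ℂ] X)) (r : ℂ → 𝔸) (B : 𝔸),
      (∀ a, ‖ι a‖ = ‖a‖) ∧ (∀ z : ℂ, 0 ≤ z.re → ι (r z) = A.resolvent z) ∧
      IsPolyResolvent r β C K ∧ IsPolyResolvent.IsNegPowLike r β B (Int.fract α) ∧
      ι (r 0 ^ ⌊α⌋₊ * B) = (-A).negPow α ∧ Function.Injective ((-A).negPow α) := by
  have hres : ∀ z : ℂ, 0 ≤ z.re → IsResolventAt A z (A.resolvent z) := fun z hz =>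
    LinearPMap.isResolventAt_resolvent (hρ z hz)
  obtain ⟨𝔸, i1, i2, i3, ι, hι, hιs⟩ := exists_normedCommRing_of_commute
    (A.resolvent '' {z : ℂ | 0 ≤ z.re}) (by
      rintro _ ⟨z, hz, rfl⟩ _ ⟨w, hw, rfl⟩
      rcases eq_or_ne w z with rfl | hzw
      · rfl
      · exact (hres z hz).commute (hres w hw) hzw)
  have hr : ∃ r : ℂ → 𝔸, ∀ z : ℂ, 0 ≤ z.re → ι (r z) = A.resolvent z := by
    choose r hr using fun z : {z : ℂ // 0 ≤ z.re} => hιs (A.resolvent z) ⟨z, z.2, rfl⟩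
    classical
    refine ⟨fun z => if h : 0 ≤ z.re then r ⟨z, h⟩ else 0, fun z hz => ?_⟩
    beta_reduce
    rw [dif_pos hz, hr]
  obtain ⟨r, hr⟩ := hr
  have hinj : Function.Injective ι := by
    rw [injective_iff_map_eq_zero]
    intro a ha
    rw [← norm_eq_zero, ← hι, ha, norm_zero]
  have hP : IsPolyResolvent r β C K :=
    { sub_eq := fun z w hz hw => hinj (by
        rw [map_sub, map_smul, map_mul, hr z hz, hr w hw]
        exact (hres z hz).sub_eq (hres w hw))
      norm_le := fun z hz => by
        rw [← hι, hr z hz]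
        exact hR z hz
      norm_ofReal_le := fun x hx => by
        rw [← hι, hr x (by simpa)]
        exact hK x hx
      nonneg := hβ
      const_nonneg := hC }
  have hR0 : ι (r 0) = A.resolvent 0 := hr 0 le_rfl
  have hinj0 : Function.Injective (ι (r 0)) := by
    rw [hR0]
    exact (hres 0 le_rfl).injective_zero
  have hinjn : ∀ n : ℕ, Function.Injective (ι (r 0 ^ n)) := by
    intro n
    induction n with
    | zero =>
      rw [pow_zero, map_one]
      exact fun _ _ h => h
    | succ n ih =>
      rw [pow_succ, map_mul]
      exact ih.comp hinj0
  obtain ⟨B, hB, hιB, hBinj⟩ : ∃ B : 𝔸, IsPolyResolvent.IsNegPowLike r β B (Int.fract α) ∧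
      ι B = (if Int.fract α = 0 then 1 else (-A).balakrishnan (Int.fract α)) ∧
      Function.Injective (ι B) := by
    by_cases hθ : Int.fract α = 0
    · refine ⟨1, ?_, ?_, ?_⟩
      · rw [hθ]
        exact hP.isNegPowLike_one
      · rw [if_pos hθ, map_one]
      · rw [map_one]
        exact fun _ _ h => h
    · set θ := Int.fract α
      have h0 : 0 < θ := lt_of_le_of_ne (Int.fract_nonneg α) (Ne.symm hθ)
      have h1 : θ < 1 := Int.fract_lt_one α
      set c := Real.sin (Real.pi * θ) / Real.pi
      have hc : c ≠ 0 := by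
        refine (div_pos (Real.sin_pos_of_pos_of_lt_pi (by positivity) ?_) Real.pi_pos).ne'
        nlinarith [Real.pi_pos]
      refine ⟨c • ∫ t in Ioi (0 : ℝ), t ^ (-θ) • r t, hP.isNegPowLike_integral h0 h1 c, ?_, ?_⟩
      · rw [if_neg hθ, LinearPMap.balakrishnan, neg_neg]
        let L : 𝔸 →L[ℝ] (X →L[ℂ] X) :=
          (ι.toLinearMap.restrictScalars ℝ).mkContinuous 1 fun a => by
            rw [one_mul]
            exact (hι a).le
        have hL : ∀ a, ι a = L a := fun a => rfl
        rw [hL, map_smul, ← L.integral_comp_comm (hP.integrableOn_rpow_smul h0 h1)]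
        congr 1
        refine setIntegral_congr_fun measurableSet_Ioi fun t ht => ?_
        have ht' : (0 : ℝ) < t := ht
        rw [map_smul, ← hL, hr t (by simpa using ht'.le)]
      -- Multiplying by the complementary integral, of order 1 - θ, gives a nonzero multiple of r 0,
      -- which is injective; hence so is this factor.
      · obtain ⟨d, hd, hde⟩ := hP.exists_integral_mul_integral_eq_smul h0 h1
        rw [injective_iff_map_eq_zero]
        intro y hy
        have e1 : (∫ t in Ioi (0 : ℝ), t ^ (-(1 - θ)) • r t) *
            (c • ∫ t in Ioi (0 : ℝ), t ^ (-θ) • r t) = ((c * d : ℝ) : ℂ) • r 0 := by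
          rw [mul_smul_comm, hde, smul_smul, Complex.coe_smul]
        have e2 := congrArg (fun a => ι a y) e1
        simp only [map_mul, map_smul] at e2
        rw [mul_apply_eq_comp, hy, map_zero, smul_apply, eq_comm, smul_eq_zero,
          or_iff_right (by exact_mod_cast mul_ne_zero hc hd)] at e2
        exact hinj0 (by rw [e2, map_zero])
  have hιn : ι (r 0 ^ ⌊α⌋₊ * B) = (-A).negPow α := by
    rw [map_mul, map_pow, hR0, hιB, LinearPMap.negPow, neg_neg]
  refine ⟨𝔸, i1, i2, ι, r, B, hι, hr, hP, hB, hιn, ?_⟩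
  rw [← hιn, map_mul]
  exact (hinjn _).comp hBinj

end FracPow

/-! ### Conclusion -/

section Main

variable {X : Type*} [NormedAddCommGroup X] [InnerProductSpace ℂ X] [CompleteSpace X]
  {T : ℝ → X →L[ℂ] X}

namespace IsC0Semigroup

/-- Beyond 2ω + 1 the Hille–Yosida bound M/(r - ω) applies; on the remaining bounded interval the
polynomial bound is just a constant. -/
theorem exists_norm_resolvent_ofReal_le (hT : IsC0Semigroup T) {M ω β C : ℝ} (hM1 : 1 ≤ M)
    (hω : 0 ≤ ω) (hM : ∀ t : ℝ, 0 ≤ t → ‖T t‖ ≤ M * Real.exp (ω * t)) (hβ : 0 ≤ β) (hC : 0 ≤ C)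
    {R : ℂ → X →L[ℂ] X}
    (hres : ∀ z : ℂ, 0 ≤ z.re → IsResolventAt (semigroupGenerator T) z (R z))
    (hR : ∀ z : ℂ, 0 ≤ z.re → ‖R z‖ ≤ C * (1 + ‖z‖) ^ β) :
    ∃ K, ∀ r : ℝ, 0 ≤ r → ‖R r‖ ≤ K / (1 + r) := by
  refine ⟨2 * M + C * (2 * ω + 2) ^ β * (2 * ω + 2), fun r hr => ?_⟩
  rw [le_div_iff₀ (by positivity)]
  rcases le_total (2 * ω + 1) r with h | h
  · have h1 := hT.norm_resolvent_le (by linarith) hM (z := r) (by simp; linarith)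
      (hres r (by simpa))
    have h2 : 0 ≤ C * (2 * ω + 2) ^ β * (2 * ω + 2) := by positivity
    have h3 : 0 < r - ω := by linarith
    rw [Complex.ofReal_re, le_div_iff₀ h3] at h1
    nlinarith [norm_nonneg (R r)]
  · have h1 := hR r (by simpa)
    rw [Complex.norm_real, Real.norm_of_nonneg hr] at h1
    have h2 : ‖R r‖ ≤ C * (2 * ω + 2) ^ β := h1.trans
      (mul_le_mul_of_nonneg_left (Real.rpow_le_rpow (by positivity) (by linarith) hβ) hC)
    calc _ ≤ C * (2 * ω + 2) ^ β * (2 * ω + 2) :=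
          mul_le_mul h2 (by linarith) (by positivity) (by positivity)
      _ ≤ _ := by linarith

end IsC0Semigroup

end Main

end

theorem theorem5p4 {X : Type*} [NormedAddCommGroup X] [InnerProductSpace ℂ X] [CompleteSpace X]
    (T : ℝ → X →L[ℂ] X) (hT : IsC0Semigroup T)
    (A : X →ₗ.[ℂ] X) (hA : A = semigroupGenerator T)
    (β C' : ℝ) (hβ : 0 ≤ β) (hC' : 0 ≤ C')
    (hρ : ∀ z : ℂ, 0 ≤ z.re → z ∈ A.resolventSet)
    (hR : ∀ z : ℂ, 0 ≤ z.re → ‖A.resolvent z‖ ≤ C' * (1 + ‖z‖) ^ β) :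
    ∀ s : ℝ, 0 ≤ s → ∃ C : ℝ, 0 ≤ C ∧
      ∀ (x : ((-A).fracPow ((s + 1) * β)).domain) (t : ℝ), 1 ≤ t →
        ‖T t (x : X)‖ ≤ C * t ^ (-s) * ((-A).fracPow ((s + 1) * β)).graphNorm x := by
  intro s hs
  set α := (s + 1) * β
  have hα : 0 ≤ α := by positivity
  have hres : ∀ z : ℂ, 0 ≤ z.re → IsResolventAt (semigroupGenerator T) z (A.resolvent z) :=
    fun z hz => hA ▸ LinearPMap.isResolventAt_resolvent (hρ z hz)
  obtain ⟨M, ω, hM1, hω, hM⟩ := hT.exists_norm_le_exp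
  obtain ⟨K, hK⟩ := hT.exists_norm_resolvent_ofReal_le hM1 hω hM hβ hC' hres hR
  obtain ⟨𝔸, i1, i2, ι, r, B, hι, hr, hP, hB, hιB, hinj⟩ := exists_negPow_model hβ hC' hρ hR hK α
  have hfloor : (⌊α⌋₊ : ℝ) + Int.fract α = α := by
    rw [natCast_floor_eq_intCast_floor hα]
    exact Int.floor_add_fract α
  have decay : ∀ N : ℕ, ∃ c, 0 ≤ c ∧ ∀ (D : 𝔸) (k : ℝ),
      (∀ z : ℂ, 0 ≤ z.re → ‖r z ^ N * D‖ ≤ k ∧ ‖r z ^ (N + 1) * D‖ ≤ k) →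
      ∀ (y : X) (t : ℝ), 1 ≤ t → ‖T t (ι D y)‖ ≤ c * k * ‖y‖ * t ^ (-(N : ℝ)) := by
    intro N
    obtain ⟨p, b, -, hb⟩ := hP.exists_norm_pow_sub_pow_mul_le (w := ω + 1) (by linarith) (N + 1)
    obtain ⟨c, hc, hcD⟩ := hT.exists_pow_mul_norm_apply_le hM1 hM hω hres N
      (hT.denseRange_resolvent_pow (hres 0 le_rfl) p) (C := b) (fun z hz => by
        have hz' : 0 ≤ (z + (ω + 1 : ℝ)).re := by
          simp
          linarith
        rw [← hr z hz, ← hr _ hz', ← hr 0 le_rfl, ← map_pow, ← map_pow, ← map_pow, ← map_sub,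
          ← map_mul, hι]
        exact hb z hz)
    refine ⟨c, hc, fun D k hk y t ht => ?_⟩
    have ht0 : 0 < t := by linarith
    have h1 := hcD (ι D) k (fun z hz => by
        rw [← hr z hz]
        exact (Commute.all D (r z)).map ι)
      (fun z hz => by
        rw [← hr z hz, ← map_pow, ← map_pow, ← map_mul, ← map_mul, hι, hι]
        exact hk z hz) y t ht
    rw [Real.rpow_neg ht0.le, Real.rpow_natCast, ← div_eq_mul_inv, le_div_iff₀ (by positivity),
      mul_comm]
    exact h1
  suffices key : ∃ C : ℝ, 0 ≤ C ∧ ∀ (y : X) (t : ℝ), 1 ≤ t →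
      ‖T t ((-A).negPow α y)‖ ≤ C * t ^ (-s) * ‖y‖ by
    obtain ⟨C, hC, hCy⟩ := key
    refine ⟨C, hC, fun x t ht => ?_⟩
    have h1 := hCy ((-A).fracPow α x) t ht
    rw [LinearPMap.negPow_fracPow_apply hinj] at h1
    refine h1.trans ?_
    rw [LinearPMap.graphNorm]
    gcongr
    exact le_add_of_nonneg_left (norm_nonneg _)
  -- For β = 0 the scale t^(1/β) is meaningless, but then α = 0 and all powers of the resolvent are
  -- bounded, so any integer N ≥ s gives the rate directly.
  rcases hβ.eq_or_lt with hβ0 | hβ0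
  · obtain ⟨N, hN⟩ := exists_nat_ge s
    obtain ⟨c, hc, hcD⟩ := decay N
    have hj : ∀ j : ℕ, (j : ℝ) * β - (⌊α⌋₊ + Int.fract α) ≤ 0 := fun j => by
      rw [hfloor, ← hβ0, mul_zero, zero_sub]
      linarith
    obtain ⟨a, ha, haz⟩ := hP.exists_norm_pow_mul_negPow_le hB ⌊α⌋₊ N le_rfl (hj N)
    obtain ⟨b, hb, hbz⟩ := hP.exists_norm_pow_mul_negPow_le hB ⌊α⌋₊ (N + 1) le_rfl (hj (N + 1))
    have hz1 : ∀ z : ℂ, 1 ≤ 1 + ‖z‖ ∧ ‖z‖ ≤ 1 + ‖z‖ := fun z =>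
      ⟨by linarith [norm_nonneg z], by linarith⟩
    refine ⟨c * (a + b), by positivity, fun y t ht => ?_⟩
    rw [← hιB]
    refine (hcD _ (a + b) (fun z hz => ⟨?_, ?_⟩) y t ht).trans ?_
    · have := haz z _ hz (hz1 z).1 (hz1 z).2
      rw [Real.rpow_zero, mul_one] at this
      linarith
    · have := hbz z _ hz (hz1 z).1 (hz1 z).2
      rw [Real.rpow_zero, mul_one] at this
      linarith
    · rw [mul_right_comm]
      gcongr
  · set N := ⌊s⌋₊
    have hN : (N : ℝ) ≤ s := Nat.floor_le hs
    have hN1 : s ≤ N + 1 := (Nat.lt_floor_add_one s).le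
    obtain ⟨c, hc, hcD⟩ := decay N
    obtain ⟨c', hc', hcE⟩ := decay (N + 1)
    -- These δ, δ' give equality in both exponent conditions: (N + 1)β + δ = α and (N + 2)β - α =
    -- δ'.
    obtain ⟨a, ha, hsplit⟩ := hP.exists_negPow_eq_add hB ⌊α⌋₊ N (δ := (s - N) * β)
      (δ' := (N + 1 - s) * β) (mul_nonneg (by linarith) hβ) (mul_nonneg (by linarith) hβ)
      (by rw [hfloor]; apply le_of_eq; simp only [α]; ring)
      (by rw [hfloor]; apply le_of_eq; simp only [α]; ring)
    refine ⟨c * a + c' * a, by positivity, fun y t ht => ?_⟩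
    have ht0 : 0 < t := by linarith
    -- At μ = t^(1/β), D contributes t^(-(s-N)) t^(-N) and E contributes t^(N+1-s) t^(-(N+1)), both
    -- equal to t^(-s).
    obtain ⟨D, E, hDE, hbd⟩ := hsplit (t ^ (1 / β)) (Real.one_le_rpow ht (by positivity))
    have e1 : (t ^ (1 / β)) ^ (-((s - N) * β)) = t ^ (-(s - N)) := by
      rw [← Real.rpow_mul ht0.le]
      congr 1
      field_simp
    have e2 : (t ^ (1 / β)) ^ ((N + 1 - s) * β) = t ^ (N + 1 - s) := by
      rw [← Real.rpow_mul ht0.le]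
      congr 1
      field_simp
    rw [e1, e2] at hbd
    have h1 := hcD D _ (fun z hz => ⟨(hbd z hz).1, (hbd z hz).2.1⟩) y t ht
    have h2 := hcE E _ (fun z hz => ⟨(hbd z hz).2.2.1, (hbd z hz).2.2.2⟩) y t ht
    have e3 : t ^ (-s) = t ^ (-(s - N)) * t ^ (-(N : ℝ)) := by
      rw [← Real.rpow_add ht0]
      congr 1
      ring
    have e4 : t ^ (-s) = t ^ (N + 1 - s) * t ^ (-((N + 1 : ℕ) : ℝ)) := by
      rw [← Real.rpow_add ht0]
      congr 1
      push_cast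
      ring
    rw [← hιB, ← hDE, map_add, add_apply, map_add]
    refine (norm_add_le _ _).trans ((add_le_add h1 h2).trans_eq ?_)
    rw [add_mul, add_mul]
    congr 1
    · rw [e3]
      ring
    · rw [e4]
      ring
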